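/- A Carnot group is a simply connected Lie group $G$ whose Lie algebra is stratified, $\mathfrak g=\mathfrak g^{[1]}\oplus\cdots\oplus\mathfrak g^{[s]}$ with $[\mathfrak g^{[1]},\mathfrak g^{[k]}]=\mathfrak g^{[k+1]}$ for all $k\ge 1$ (where $\mathfrak g^{[k]}=0$ for $k>s$), and carries an inner product for which the layers are pairwise orthogonal. Its rank is $\dim\mathfrak g^{[1]}$, and $d$ denotes its sub-Riemannian distance: the infimum of the lengths of the absolutely continuous curves tangent to the left translates of $\mathfrak g^{[1]}$ that join two points. A map $f$ between subsets of Carnot groups is $\gamma$-Hölder ($0<\gamma\le 1$) if $d(f(x),f(y))\le C\,d(x,y)^{\gamma}$ for some constant $C$ and all $x,y$. A central extension of Carnot groups $V\xrightarrow{\iota}G\xrightarrow{\pi}H$ consists of Carnot groups $G,H$, a finite-dimensional graded inner product space $V$, a 2-cocycle $\rho$ on $\mathfrak h$ with values in $V$ and a linear identification $\mathfrak g=\mathfrak h\oplus V$ under which $[X+A,Y+B]=[X,Y]+\rho(X,Y)$, such that the inclusion $\iota_*:V\to\mathfrak g$ and the projection $\pi_*:\mathfrak g\to\mathfrak h$ are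 graded, $\iota_*$ is an isometry and $\pi_*$ is a submetry, together with the induced short exact sequence of Lie groups. We regard $V$ as a subgroup of $G$ through $\iota$. **Theorem 6.6.** Let $V_1\to G_1\xrightarrow{\pi_1}H_1$ and $V_2\to G_2\xrightarrow{\pi_2}H_2$ be central extensions of Carnot groups such that $\mathrm{rank}(G_2)=\mathrm{rank}(H_2)$, and let $\tfrac12<\beta\le 1$. (a) Let $U_1\subset H_1$ be a domain (a non-empty connected open set), let $f:U_1\to H_2$ be a Hölder map (of some exponent in $(0,1]$), and let $F:\pi_1^{-1}(U_1)\to G_2$ be a $\beta$-Hölder lift of $f$, that is, a $\beta$-Hölder map with $\pi_2\circ F=f\circ\pi_1$. Then there exists a Lie group homomorphism $\Phi:V_1\to V_2$ such that $F(gk)=F(g)\Phi(k)$ for all $g\in\pi_1^{-1}(U_1)$ and all $k\in V_1$. (b) Let $B\subset G_1$ be an open ball for the sub-Riemannian distance. Every map $h:B\to V_2$ that is $\beta$-Hölder with respect to the sub-Riemannian distances of $G_1$ and $G_2$ (the latter restricted to $V_2\subset G_2$) is constant. -/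

import Mathlib

open Set MeasureTheory
open scoped Manifold ContDiff NNReal ENNReal

noncomputable section

universe u v w

/-- A (sub-Riemannian) Carnot group: a simply connected real Lie group whose Lie algebra
(Mathlib's `GroupLieAlgebra`, the tangent space at the identity with the bracket of left-invariant
vector fields) is stratified, `𝔤 = 𝔤^[1] ⊕ ⋯ ⊕ 𝔤^[s]` with `[𝔤^[1], 𝔤^[k]] = 𝔤^[k+1]` for all
`k ≥ 1`, and carries an inner product for which the layers are pairwise orthogonal. The layers are
indexed by `ℕ`, and the layer of index `0` is `{0}`. (Nilpotency follows from the
stratification.) -/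
structure CarnotGroup where
  /-- the underlying set -/
  carrier : Type u
  /-- the dimension of the manifold -/
  dim : ℕ
  [top : TopologicalSpace carrier]
  [charted : ChartedSpace (EuclideanSpace ℝ (Fin dim)) carrier]
  [group : Group carrier]
  [lieGroup : LieGroup 𝓘(ℝ, EuclideanSpace ℝ (Fin dim)) ∞ carrier]
  [t2 : T2Space carrier]
  [simplyConnected : SimplyConnectedSpace carrier]
  /-- the layers `𝔤^[k]` -/
  layer : ℕ → Submodule ℝ (GroupLieAlgebra 𝓘(ℝ, EuclideanSpace ℝ (Fin dim)) carrier)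
  /-- the step `s` -/
  step : ℕ
  layer_zero : layer 0 = ⊥
  layer_eq_bot : ∀ k, step < k → layer k = ⊥
  layer_isInternal : DirectSum.IsInternal layer
  span_bracket : ∀ k, 1 ≤ k →
    Submodule.span ℝ {Z | ∃ X ∈ layer 1, ∃ Y ∈ layer k, ⁅X, Y⁆ = Z} = layer (k + 1)
  /-- the inner product on the Lie algebra -/
  ip : LinearMap.BilinForm ℝ (GroupLieAlgebra 𝓘(ℝ, EuclideanSpace ℝ (Fin dim)) carrier)
  ip_symm : ∀ X Y, ip X Y = ip Y X
  ip_pos : ∀ X, X ≠ 0 → 0 < ip X X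
  ip_orthogonal : ∀ j k, j ≠ k → ∀ X ∈ layer j, ∀ Y ∈ layer k, ip X Y = 0

namespace CarnotGroup

instance : CoeSort CarnotGroup.{u} (Type u) := ⟨carrier⟩

attribute [instance] top charted group lieGroup t2 simplyConnected

variable (G : CarnotGroup.{u}) (H : CarnotGroup.{v})

/-- The model with corners of the manifold `G`. -/
abbrev model : ModelWithCorners ℝ (EuclideanSpace ℝ (Fin G.dim)) (EuclideanSpace ℝ (Fin G.dim)) :=
  𝓘(ℝ, EuclideanSpace ℝ (Fin G.dim))

/-- The Lie algebra `𝔤 = T_e G`. -/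
abbrev LieAlg : Type := GroupLieAlgebra G.model G.carrier

/-- The horizontal rank `dim 𝔤^[1]`. -/
def rank : ℕ := Module.finrank ℝ (G.layer 1)

/-- The norm of the inner product on the Lie algebra. -/
def algNorm (X : G.LieAlg) : ℝ := Real.sqrt (G.ip X X)

/-- The left-trivialized derivative `(L_{γ(t)}⁻¹)_* γ'(t)`. It is a tangent vector at
`γ(t)⁻¹ γ(t) = e`. -/
def leftDeriv (γ : ℝ → G) (t : ℝ) : G.LieAlg :=
  mfderiv G.model G.model (fun x : G => (γ t)⁻¹ * x) (γ t) (mfderiv 𝓘(ℝ, ℝ) G.model γ t (1 : ℝ))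

/-- A horizontal curve on `[0,1]`: an absolutely continuous curve whose left-trivialized derivative
lies in the first layer almost everywhere. Absolute continuity of a curve in a manifold means that
its composition with every smooth real function is absolutely continuous (equivalently, the curve
is continuous and absolutely continuous in charts); only the values on `[0,1]` matter. -/
structure IsHorizontal (γ : ℝ → G) : Prop where
  absolutelyContinuous : ∀ φ : G → ℝ, ContMDiff G.model 𝓘(ℝ, ℝ) ∞ φ →
    AbsolutelyContinuousOnInterval (fun t => φ (γ t)) 0 1
  horizontal : ∀ᵐ t ∂(volume.restrict (Icc (0 : ℝ) 1)), G.leftDeriv γ t ∈ G.layer 1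

/-- The length `∫₀¹ ‖(L_{γ(t)}⁻¹)_* γ'(t)‖ dt`. -/
def length (γ : ℝ → G) : ℝ≥0∞ :=
  ∫⁻ t in Icc (0 : ℝ) 1, ENNReal.ofReal (G.algNorm (G.leftDeriv γ t))

/-- The sub-Riemannian (Carnot-Carathéodory) distance: the infimum of the lengths of the horizontal
curves from `g` to `h`. It takes values in `[0,∞]`, so that no finiteness is built in. -/
def ccDist (g h : G) : ℝ≥0∞ :=
  ⨅ (γ : ℝ → G) (_ : G.IsHorizontal γ ∧ γ 0 = g ∧ γ 1 = h), G.length γ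

/-- The open ball of radius `r` for the sub-Riemannian distance. -/
def ball (x : G) (r : ℝ) : Set G := {g | G.ccDist x g < ENNReal.ofReal r}

variable {G H} in
/-- `f` is `β`-Hölder continuous on `s`, for the sub-Riemannian distances. -/
def IsHolderOn (β : ℝ) (s : Set G) (f : G → H) : Prop :=
  ∃ C : ℝ≥0, ∀ x ∈ s, ∀ y ∈ s, H.ccDist (f x) (f y) ≤ C * G.ccDist x y ^ β

end CarnotGroup

/-- A central extension of Carnot groups `V → G → H` by a `2`-cocycle `ρ`. At the level of Lie
algebras, `𝔤` is identified with `𝔥 ⊕ V` by a linear isomorphism `split` that carries the bracket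
of `𝔤` to `[X + A, Y + B] = [X, Y] + ρ(X, Y)`; so `ι_* v = split⁻¹ (0, v)` and `π_*` is the first
component of `split`. These two maps are graded, `ι_*` is an isometry, and `π_*` is a submetry (it
maps balls onto balls of the same radius). At the level of groups, `incl` and `proj` are the smooth
homomorphisms with differentials `ι_*` and `π_*`, and they form a short exact sequence. -/
structure CentralExtension (V : Type w) [NormedAddCommGroup V] [InnerProductSpace ℝ V]
    [FiniteDimensional ℝ V] (G : CarnotGroup.{u}) (H : CarnotGroup.{v}) where
  /-- the grading of `V` -/
  vlayer : ℕ → Submodule ℝ V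
  vlayer_zero : vlayer 0 = ⊥
  vlayer_isInternal : DirectSum.IsInternal vlayer
  /-- the `2`-cocycle `ρ` -/
  ρ : H.LieAlg →ₗ[ℝ] H.LieAlg →ₗ[ℝ] V
  ρ_alternating : ∀ X, ρ X X = 0
  ρ_cocycle : ∀ X Y Z, ρ ⁅X, Y⁆ Z + ρ ⁅Y, Z⁆ X + ρ ⁅Z, X⁆ Y = 0
  /-- the decomposition `𝔤 = 𝔥 ⊕ V` -/
  split : G.LieAlg ≃ₗ[ℝ] H.LieAlg × V
  split_bracket : ∀ X Y : G.LieAlg,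
    split ⁅X, Y⁆ = (⁅(split X).1, (split Y).1⁆, ρ (split X).1 (split Y).1)
  incl_graded : ∀ k, ∀ v ∈ vlayer k, split.symm (0, v) ∈ G.layer k
  proj_graded : ∀ k, ∀ X ∈ G.layer k, (split X).1 ∈ H.layer k
  incl_isometry : ∀ v v' : V, G.ip (split.symm (0, v)) (split.symm (0, v')) = inner ℝ v v'
  proj_submetry : ∀ (X : G.LieAlg) (r : ℝ), 0 < r →
    (fun X' => (split X').1) '' {X' | G.algNorm (X' - X) < r} =
      {Y | H.algNorm (Y - (split X).1) < r}
  /-- the inclusion `ι : V → G` -/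
  incl : V → G
  incl_add : ∀ v v', incl (v + v') = incl v * incl v'
  incl_smooth : ContMDiff 𝓘(ℝ, V) G.model ∞ incl
  mfderiv_incl : ∀ v : V, (mfderiv 𝓘(ℝ, V) G.model incl 0 v : G.LieAlg) = split.symm (0, v)
  /-- the projection `π : G → H` -/
  proj : G →* H
  proj_smooth : ContMDiff G.model H.model ∞ proj
  mfderiv_proj : ∀ X : G.LieAlg, (mfderiv G.model H.model proj 1 X : H.LieAlg) = (split X).1
  incl_injective : Function.Injective incl
  exact : ∀ g : G, proj g = 1 ↔ ∃ v, incl v = g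
  proj_surjective : Function.Surjective proj

end

/-! The extension of `G₂` does not change the rank, so the surjection of first layers induced by the
projection is injective, and the kernel `V₂` meets the first layer of `𝔤₂` only in `0`. Hence some
linear retraction `P : 𝔤₂ → V₂` kills the first layer. Read in a chart at the identity and cut off
by a bump function, the components of `P` are smooth functions whose horizontal differential
vanishes at `1`. Integrating twice along horizontal curves bounds them by `C d(1, ·)²`, so `‖v‖ ≤ C
d(1, ι v)²` whenever `ι v` is close to `1` (`exists_norm_le_ccDist_sq`). A `β`-Hölder map into `V₂`
is therefore locally `2β`-Hölder for the norm, and since `2β > 1` it is constant along rectifiable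
horizontal curves (`eq_of_edist_le_length_rpow`, `eq_of_holder_on_curve`).

For (b) this is enough: each point of a ball is joined to the centre by a curve shorter than the
radius, and such a curve stays in the ball.

For (a), fix `k`. Since `F` lifts a map of the base, `F (g k) = F g · ι (h_k g)`. Centrality of the
kernels makes right translation by `k` an isometry and bounds `d(1, ι (h_k p - h_k q))` by `d(F p, F
q) + d(F (p k), F (q k))`, so `h_k` is `β`-Hölder. Chow's theorem makes it locally constant, and the
preimage of the domain is connected because `π₁` is open with connected fibres. The constant value
`Φ k` is additive and continuous in `k`, hence linear.

Two facts about the groups are derived along the way. Chow's theorem holds because derivatives of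
the adjoint action are brackets, so conjugates of short horizontal curves move in all directions.
Centrality of the kernel in the group follows from its centrality in the Lie algebra, as the adjoint
action then fixes it. -/

open Filter Topology

set_option linter.unusedSectionVars false

noncomputable section

universe u v w

/-! ### Second-order calculus in a local Lie group. -/

section Calculus

variable {E : Type*} [NormedAddCommGroup E] [NormedSpace ℝ E]

/-- In the notation of a local Lie group with product `M`, unit `e` and conjugation `C`, the
derivative at the unit of `x ↦ Ad x Z` is the bracket with `Z`. -/
theorem hasFDerivAt_conj_of_local_group {M C : E × E → E} {e : E}
    (hM : ContDiffAt ℝ 2 M (e, e)) (hC : ContDiffAt ℝ 2 C (e, e))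
    (hMr : ∀ᶠ x in 𝓝 e, M (x, e) = x)
    (hCl : ∀ᶠ y in 𝓝 e, C (e, y) = y) (hCe : ∀ᶠ x in 𝓝 e, C (x, e) = e)
    (hMC : ∀ᶠ p : E × E in 𝓝 (e, e), M (C p, p.1) = M p) (Z : E) :
    ∃ A : E →L[ℝ] E, HasFDerivAt (fun x => fderiv ℝ (fun y => C (x, y)) e Z) A e ∧
      ∀ Y, A Y = fderiv ℝ (fun x => fderiv ℝ (fun y => M (x, y)) e Z) e Y -
        fderiv ℝ (fun x => fderiv ℝ (fun y => M (x, y)) e Y) e Z := by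
  have dM : ∀ᶠ p in 𝓝 (e, e), DifferentiableAt ℝ M p :=
    (hM.eventually (by simp)).mono fun p hp => hp.differentiableAt (by simp)
  have dC : ∀ᶠ p in 𝓝 (e, e), DifferentiableAt ℝ C p :=
    (hC.eventually (by simp)).mono fun p hp => hp.differentiableAt (by simp)
  have hl : Tendsto (fun y : E => (e, y)) (𝓝 e) (𝓝 (e, e)) :=
    (Continuous.prodMk continuous_const continuous_id).tendsto' _ _ rfl
  have hr : Tendsto (fun x : E => (x, e)) (𝓝 e) (𝓝 (e, e)) :=
    (Continuous.prodMk continuous_id continuous_const).tendsto' _ _ rfl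
  have hinr : ∀ (x y : E), HasFDerivAt (fun y : E => (x, y)) (ContinuousLinearMap.inr ℝ E E) y :=
    fun x y => hasFDerivAt_prodMk_right x y
  have hinl : ∀ (x y : E), HasFDerivAt (fun x : E => (x, y)) (ContinuousLinearMap.inl ℝ E E) x :=
    fun x y => hasFDerivAt_prodMk_left x y
  -- partial derivatives
  have pM : ∀ᶠ x in 𝓝 e, ∀ W, fderiv ℝ (fun y => M (x, y)) e W = fderiv ℝ M (x, e) (0, W) := by
    filter_upwards [hr.eventually dM] with x hx W
    have := (HasFDerivAt.comp (f := fun y : E => (x, y)) e hx.hasFDerivAt (hinr x e)).fderiv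
    have h2 := congrArg (fun L => L W) this
    simpa [Function.comp_def] using h2
  have pC : ∀ᶠ x in 𝓝 e, ∀ W, fderiv ℝ (fun y => C (x, y)) e W = fderiv ℝ C (x, e) (0, W) := by
    filter_upwards [hr.eventually dC] with x hx W
    have := (HasFDerivAt.comp (f := fun y : E => (x, y)) e hx.hasFDerivAt (hinr x e)).fderiv
    have h2 := congrArg (fun L => L W) this
    simpa [Function.comp_def] using h2
  have d2M : DifferentiableAt ℝ (fderiv ℝ M) (e, e) :=
    (hM.fderiv_right (m := 1) (by norm_num)).differentiableAt (by simp)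
  have d2C : DifferentiableAt ℝ (fderiv ℝ C) (e, e) :=
    (hC.fderiv_right (m := 1) (by norm_num)).differentiableAt (by simp)
  set B := fderiv ℝ (fderiv ℝ M) (e, e) with hB
  have symB : ∀ u v, B u v = B v u := by
    intro u v
    exact (hM.isSymmSndFDerivAt (by simp)).eq u v
  have B2 : ∀ W, HasFDerivAt (fun x => fderiv ℝ M (x, e) (0, W))
      ((ContinuousLinearMap.apply ℝ E ((0, W) : E × E)).comp
        (B.comp (ContinuousLinearMap.inl ℝ E E))) e := fun W =>
    HasFDerivAt.comp (g := fun L : E × E →L[ℝ] E => L (0, W)) e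
      (ContinuousLinearMap.apply ℝ E ((0, W) : E × E)).hasFDerivAt
      (HasFDerivAt.comp (f := fun x : E => (x, e)) e d2M.hasFDerivAt (hinl e e))
  have B1 : HasFDerivAt (fun y => fderiv ℝ M (e, y)) (B.comp (ContinuousLinearMap.inr ℝ E E)) e :=
    d2M.hasFDerivAt.comp e (hinr e e)
  have hMfd : ∀ W Y, fderiv ℝ (fun x => fderiv ℝ (fun y => M (x, y)) e W) e Y =
      B (Y, 0) (0, W) := by
    intro W Y
    have : (fun x => fderiv ℝ (fun y => M (x, y)) e W) =ᶠ[𝓝 e]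
        fun x => fderiv ℝ M (x, e) (0, W) := pM.mono fun x hx => hx W
    rw [this.fderiv_eq, (B2 W).fderiv]; simp
  -- the derivative of the conjugation
  have DC : HasFDerivAt (fun x => fderiv ℝ C (x, e) (0, Z))
      ((ContinuousLinearMap.apply ℝ E ((0, Z) : E × E)).comp
        ((fderiv ℝ (fderiv ℝ C) (e, e)).comp (ContinuousLinearMap.inl ℝ E E))) e :=
    HasFDerivAt.comp (g := fun L : E × E →L[ℝ] E => L (0, Z)) e
      (ContinuousLinearMap.apply ℝ E ((0, Z) : E × E)).hasFDerivAt
      (HasFDerivAt.comp (f := fun x : E => (x, e)) e d2C.hasFDerivAt (hinl e e))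
  set A := ((ContinuousLinearMap.apply ℝ E ((0, Z) : E × E)).comp
        ((fderiv ℝ (fderiv ℝ C) (e, e)).comp (ContinuousLinearMap.inl ℝ E E))) with hA
  refine ⟨A, DC.congr_of_eventuallyEq (pC.mono fun x hx => hx Z), fun Y => ?_⟩
  rw [hMfd, hMfd]
  -- the relation between the partial derivatives
  have rel : (fun x => fderiv ℝ M (e, x) (fderiv ℝ C (x, e) (0, Z), 0)) =ᶠ[𝓝 e]
      fun x => fderiv ℝ M (x, e) (0, Z) := by
    have h2 : ∀ᶠ p in 𝓝 (e, e), ∀ᶠ p' in 𝓝 p, M (C p', p'.1) = M p' := hMC.eventually_nhds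
    filter_upwards [hr.eventually h2, hr.eventually dM, hl.eventually dM, hr.eventually dC, hCe]
      with x h1 h3 h4 h5 h6
    -- With `x` fixed, both sides of `(x y x⁻¹) x = x y` are differentiated in `y` at the unit.
    have e1 : HasFDerivAt (fun y => M (C (x, y), x)) ((fderiv ℝ M (e, x)).comp
        ((((fderiv ℝ C (x, e)).comp (ContinuousLinearMap.inr ℝ E E))).prod 0)) e := by
      have hc : HasFDerivAt (fun y => (C (x, y), x))
        ((((fderiv ℝ C (x, e)).comp (ContinuousLinearMap.inr ℝ E E))).prod (0 : E →L[ℝ] E)) e :=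
        (h5.hasFDerivAt.comp e (hinr x e)).prodMk (hasFDerivAt_const x e)
      have h4' : HasFDerivAt M (fderiv ℝ M (e, x)) (C (x, e), x) := by rw [h6]; exact h4.hasFDerivAt
      exact h4'.comp e hc
    have e2 : HasFDerivAt (fun y => M (x, y)) ((fderiv ℝ M (x, e)).comp
        (ContinuousLinearMap.inr ℝ E E)) e := h3.hasFDerivAt.comp e (hinr x e)
    have hx : Tendsto (fun y : E => (x, y)) (𝓝 e) (𝓝 (x, e)) :=
      (Continuous.prodMk continuous_const continuous_id).tendsto' _ _ rfl
    have e3 : (fun y => M (C (x, y), x)) =ᶠ[𝓝 e] fun y => M (x, y) := hx.eventually h1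
    have := congrArg (fun L => L Z) ((e1.congr_of_eventuallyEq e3.symm).unique e2)
    simpa using this
  have C0 : fderiv ℝ C (e, e) (0, Z) = Z := by
    have := pC.self_of_nhds Z
    rw [← this]
    have h : (fun y => C (e, y)) =ᶠ[𝓝 e] id := hCl
    rw [h.fderiv_eq, fderiv_id]; rfl
  have M0 : ∀ W, fderiv ℝ M (e, e) (W, 0) = W := by
    intro W
    have h : (fun x => M (x, e)) =ᶠ[𝓝 e] id := hMr
    have h' := (HasFDerivAt.comp (f := fun x : E => (x, e)) e dM.self_of_nhds.hasFDerivAt (hinl e e)).fderiv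
    have h'' : fderiv ℝ (M ∘ fun x => (x, e)) e = ContinuousLinearMap.id ℝ E := by
      rw [← fderiv_id (𝕜 := ℝ) (x := e)]; exact h.fderiv_eq
    rw [h''] at h'
    have := congrArg (fun L => L W) h'
    simpa using this.symm
  -- Differentiating once more, in `x` along `Y`, gives `A Y + B (0, Y) (Z, 0) = B (Y, 0) (0, Z)`;
  -- the symmetry of `B` then produces the antisymmetrized mixed derivative.
  have L1 : HasFDerivAt (fun x => fderiv ℝ M (e, x) (fderiv ℝ C (x, e) (0, Z), 0))
      (((fderiv ℝ M (e, e))).comp (A.prod (0 : E →L[ℝ] E)) +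
        (B.comp (ContinuousLinearMap.inr ℝ E E)).flip (fderiv ℝ C (e, e) (0, Z), 0)) e :=
    B1.clm_apply (DC.prodMk (hasFDerivAt_const (0 : E) e))
  have := congrArg (fun L => L Y) ((L1.congr_of_eventuallyEq rel.symm).unique (B2 Z))
  simp only [add_apply, ContinuousLinearMap.comp_apply,
    ContinuousLinearMap.flip_apply, ContinuousLinearMap.prod_apply, zero_apply,
    C0, M0, ContinuousLinearMap.inr_apply, ContinuousLinearMap.inl_apply,
    ContinuousLinearMap.apply_apply] at this
  rw [← this, symB (0, Y) (Z, 0)]; abel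

end Calculus

/-! ### The chart at the identity, the adjoint action and the bracket. -/

section LieGroupChart

variable {E : Type*} [NormedAddCommGroup E] [NormedSpace ℝ E]
  {G : Type*} [TopologicalSpace G] [ChartedSpace E G] [Group G] [LieGroup 𝓘(ℝ, E) ∞ G]

/-- Typing the derivative on the model spaces lets base points that are only propositionally equal
be exchanged without casts between tangent spaces. -/
theorem hasMFDerivAt_congr_point {E' G' : Type*} [NormedAddCommGroup E'] [NormedSpace ℝ E']
    [TopologicalSpace G'] [ChartedSpace E' G'] {f : G → G'} {x y : G} {L : E →L[ℝ] E'}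
    (hf : HasMFDerivAt 𝓘(ℝ, E) 𝓘(ℝ, E') f x L) (h : x = y) :
    HasMFDerivAt 𝓘(ℝ, E) 𝓘(ℝ, E') f y L := by
  subst h; exact hf

theorem contMDiff_conj (g : G) : ContMDiff 𝓘(ℝ, E) 𝓘(ℝ, E) ∞ (fun y : G => g * y * g⁻¹) :=
  (contMDiff_mul_right (a := g⁻¹)).comp (contMDiff_mul_left (a := g))

variable (E) in
/-- The adjoint action of a Lie group on its Lie algebra. -/
def adj (g : G) : E →L[ℝ] E := mfderiv 𝓘(ℝ, E) 𝓘(ℝ, E) (fun y : G => g * y * g⁻¹) 1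

theorem hasMFDerivAt_conj (g : G) :
    HasMFDerivAt 𝓘(ℝ, E) 𝓘(ℝ, E) (fun y : G => g * y * g⁻¹) 1 (adj E g) :=
  ((contMDiff_conj g).mdifferentiable (by simp)).mdifferentiableAt.hasMFDerivAt

theorem adj_one : adj E (1 : G) = ContinuousLinearMap.id ℝ E := by
  have h : (fun y : G => (1 : G) * y * (1 : G)⁻¹) = id := by ext; simp
  have h1 := hasMFDerivAt_conj (E := E) (1 : G)
  rw [h] at h1
  exact hasMFDerivAt_unique h1 (hasMFDerivAt_id 1)

theorem adj_mul (g h : G) : adj E (g * h) = (adj E g).comp (adj E h) := by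
  have h1 := hasMFDerivAt_conj (E := E) (g * h)
  have h2 := HasMFDerivAt.comp (1 : G)
    (hasMFDerivAt_congr_point (hasMFDerivAt_conj (E := E) g) (show 1 = h * 1 * h⁻¹ by simp))
    (hasMFDerivAt_conj (E := E) h)
  have h3 : (fun y : G => g * h * y * (g * h)⁻¹) =
      (fun y : G => g * y * g⁻¹) ∘ fun y : G => h * y * h⁻¹ := by
    ext y; simp [mul_assoc]
  rw [h3] at h1
  exact hasMFDerivAt_unique h1 h2

variable (E G) in
/-- The preferred chart at the identity. -/
def chartOne : PartialEquiv G E := extChartAt 𝓘(ℝ, E) (1 : G)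

variable (E G) in
/-- The coordinates of the identity in the preferred chart. -/
def coordOne : E := chartOne E G 1

theorem chartOne_one : chartOne E G 1 = coordOne E G := rfl

theorem one_mem_chartOne_source : (1 : G) ∈ (chartOne E G).source :=
  mem_extChartAt_source (I := 𝓘(ℝ, E)) (1 : G)

@[simp] theorem chartOne_symm_coordOne : (chartOne E G).symm (coordOne E G) = 1 :=
  (chartOne E G).left_inv one_mem_chartOne_source

theorem chartOne_target_mem_nhds : (chartOne E G).target ∈ 𝓝 (coordOne E G) :=
  extChartAt_target_mem_nhds (I := 𝓘(ℝ, E)) (1 : G)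

theorem chartOne_source_mem_nhds : (chartOne E G).source ∈ 𝓝 (1 : G) :=
  extChartAt_source_mem_nhds (I := 𝓘(ℝ, E)) (1 : G)

theorem tendsto_chartOne : Tendsto (chartOne E G) (𝓝 1) (𝓝 (coordOne E G)) :=
  continuousAt_extChartAt (I := 𝓘(ℝ, E)) (1 : G)

theorem tendsto_chartOne_symm : Tendsto (chartOne E G).symm (𝓝 (coordOne E G)) (𝓝 1) := by
  have := (continuousAt_extChartAt_symm (I := 𝓘(ℝ, E)) (1 : G)).tendsto
  rwa [extChartAt_to_inv] at this

theorem contMDiffAt_chartOne :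
    ContMDiffAt 𝓘(ℝ, E) 𝓘(ℝ, E) ∞ (chartOne E G) 1 :=
  contMDiffAt_extChartAt

theorem contMDiffAt_chartOne_symm :
    ContMDiffAt 𝓘(ℝ, E) 𝓘(ℝ, E) ∞ (chartOne E G).symm (coordOne E G) :=
  (contMDiffOn_extChartAt_symm (1 : G)).contMDiffAt chartOne_target_mem_nhds

theorem contDiffAt_inChart {Φ : G × G → G}
    (hΦ : ContMDiff (𝓘(ℝ, E).prod 𝓘(ℝ, E)) 𝓘(ℝ, E) ∞ Φ) (h1 : Φ (1, 1) = 1) :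
    ContDiffAt ℝ ∞ (fun p : E × E => chartOne E G
      (Φ ((chartOne E G).symm p.1, (chartOne E G).symm p.2))) (coordOne E G, coordOne E G) := by
  rw [← contMDiffAt_iff_contDiffAt]
  have hs := contMDiffAt_chartOne_symm (E := E) (G := G)
  have h₁ : ContMDiffAt 𝓘(ℝ, E × E) 𝓘(ℝ, E) ∞ (fun p : E × E => (chartOne E G).symm p.1)
      (coordOne E G, coordOne E G) :=
    ContMDiffAt.comp (g := (chartOne E G).symm) (coordOne E G, coordOne E G) hs
      contDiffAt_fst.contMDiffAt
  have h₂ : ContMDiffAt 𝓘(ℝ, E × E) 𝓘(ℝ, E) ∞ (fun p : E × E => (chartOne E G).symm p.2)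
      (coordOne E G, coordOne E G) :=
    ContMDiffAt.comp (g := (chartOne E G).symm) (coordOne E G, coordOne E G) hs
      contDiffAt_snd.contMDiffAt
  have he : Φ ((chartOne E G).symm (coordOne E G), (chartOne E G).symm (coordOne E G)) = 1 := by
    simp [h1]
  have hc : ContMDiffAt 𝓘(ℝ, E) 𝓘(ℝ, E) ∞ (chartOne E G)
      (Φ ((chartOne E G).symm (coordOne E G), (chartOne E G).symm (coordOne E G))) := by
    rw [he]; exact contMDiffAt_chartOne
  exact ContMDiffAt.comp (coordOne E G, coordOne E G) hc (hΦ.contMDiffAt.comp _ (h₁.prodMk h₂))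

theorem hasMFDerivAt_one_iff {E' : Type*} [NormedAddCommGroup E'] [NormedSpace ℝ E']
    {f : G → E'} {L : E →L[ℝ] E'} : HasMFDerivAt 𝓘(ℝ, E) 𝓘(ℝ, E') f 1 L ↔
      ContinuousAt f 1 ∧
        HasFDerivAt (fun y => f ((chartOne E G).symm y)) L (coordOne E G) := by
  simp only [HasMFDerivAt, writtenInExtChartAt, modelWithCornersSelf_coe, range_id]
  exact and_congr_right fun _ => hasFDerivWithinAt_univ

theorem hasMFDerivAt_chartOne : HasMFDerivAt 𝓘(ℝ, E) 𝓘(ℝ, E) (chartOne E G) 1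
    (ContinuousLinearMap.id ℝ E) := by
  refine hasMFDerivAt_one_iff.2 ⟨tendsto_chartOne, ?_⟩
  have : (fun y => chartOne E G ((chartOne E G).symm y)) =ᶠ[𝓝 (coordOne E G)] id := by
    filter_upwards [chartOne_target_mem_nhds (E := E) (G := G)] with y hy
    exact (chartOne E G).right_inv hy
  exact (hasFDerivAt_id _).congr_of_eventuallyEq this

/-- The derivatives of the chart and of its inverse are mutually inverse, so the pullback is the
derivative of the chart composed with that of left translation. -/
theorem mpullback_chartOne_symm_mulInvariantVectorField [CompleteSpace E] (Z : E) :
    ∀ᶠ x in 𝓝 (coordOne E G), VectorField.mpullbackWithin 𝓘(ℝ, E) 𝓘(ℝ, E) (chartOne E G).symm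
      (mulInvariantVectorField (I := 𝓘(ℝ, E)) (G := G) Z) (range 𝓘(ℝ, E)) x =
      fderiv ℝ (fun y => chartOne E G ((chartOne E G).symm x * (chartOne E G).symm y))
        (coordOne E G) Z := by
  have : IsManifold 𝓘(ℝ, E) 1 G := IsManifold.of_le (n := ∞) (by norm_num)
  filter_upwards [chartOne_target_mem_nhds (E := E) (G := G)] with x hx
  have hxs : (chartOne E G).symm x ∈ (chartOne E G).source := (chartOne E G).map_target hx
  rw [VectorField.mpullbackWithin_apply]
  have e1 := mfderiv_extChartAt_comp_mfderivWithin_extChartAt_symm (I := 𝓘(ℝ, E)) hx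
  have e2 := mfderivWithin_extChartAt_symm_comp_mfderiv_extChartAt (I := 𝓘(ℝ, E)) hx
  rw [chartOne, ContinuousLinearMap.inverse_eq e2 e1]
  have hl : HasMFDerivAt 𝓘(ℝ, E) 𝓘(ℝ, E) (fun y : G => (chartOne E G).symm x * y) 1
      (mfderiv 𝓘(ℝ, E) 𝓘(ℝ, E) (fun y : G => (chartOne E G).symm x * y) 1) :=
    ((contMDiff_mul_left (n := ∞)).mdifferentiable (by simp) 1).hasMFDerivAt
  have hch : HasMFDerivAt 𝓘(ℝ, E) 𝓘(ℝ, E) (chartOne E G) ((chartOne E G).symm x)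
      (mfderiv 𝓘(ℝ, E) 𝓘(ℝ, E) (chartOne E G) ((chartOne E G).symm x)) :=
    (mdifferentiableAt_extChartAt (by simpa [chartOne] using hxs)).hasMFDerivAt
  have h3 := HasMFDerivAt.comp (1 : G) (hasMFDerivAt_congr_point hch (mul_one _).symm) hl
  have h4 := (hasMFDerivAt_one_iff.1 h3).2.fderiv
  exact (congrArg (fun L : E →L[ℝ] E => L Z) h4).symm

/-- In the chart the left-invariant fields take the values `Y` and `Z` at the unit and the chart has
derivative `id` there, so only the two cross derivatives of the fields remain. -/
theorem lie_eq_fderiv_chart [CompleteSpace E] (Y Z : GroupLieAlgebra 𝓘(ℝ, E) G) :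
    (⁅Y, Z⁆ : GroupLieAlgebra 𝓘(ℝ, E) G) =
      fderiv ℝ (fun x => fderiv ℝ (fun y => chartOne E G ((chartOne E G).symm x *
        (chartOne E G).symm y)) (coordOne E G) Z) (coordOne E G) Y -
      fderiv ℝ (fun x => fderiv ℝ (fun y => chartOne E G ((chartOne E G).symm x *
        (chartOne E G).symm y)) (coordOne E G) Y) (coordOne E G) Z := by
  have hid : (fun y => chartOne E G ((chartOne E G).symm (coordOne E G) *
      (chartOne E G).symm y)) =ᶠ[𝓝 (coordOne E G)] id := by
    filter_upwards [chartOne_target_mem_nhds (E := E) (G := G)] with y hy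
    simp [(chartOne E G).right_inv hy]
  have hv : ∀ W : E, fderiv ℝ (fun y => chartOne E G ((chartOne E G).symm (coordOne E G) *
      (chartOne E G).symm y)) (coordOne E G) W = W := by
    intro W; rw [hid.fderiv_eq, fderiv_id]; rfl
  let V : E → E → E := fun W => VectorField.mpullbackWithin 𝓘(ℝ, E) 𝓘(ℝ, E) (chartOne E G).symm
      (mulInvariantVectorField (I := 𝓘(ℝ, E)) (G := G) W) (range 𝓘(ℝ, E))
  have hV : ∀ W : E, V W =ᶠ[𝓝 (coordOne E G)] fun x => fderiv ℝ (fun y => chartOne E G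
      ((chartOne E G).symm x * (chartOne E G).symm y)) (coordOne E G) W := fun W =>
    mpullback_chartOne_symm_mulInvariantVectorField (G := G) W
  have hV0 : ∀ W : E, V W (coordOne E G) = W := fun W => ((hV W).self_of_nhds).trans (hv W)
  have e2 : ∀ L : E →L[ℝ] E, HasMFDerivAt 𝓘(ℝ, E) 𝓘(ℝ, E) (chartOne E G) 1 L →
      (⁅Y, Z⁆ : GroupLieAlgebra 𝓘(ℝ, E) G) =
      L.inverse (VectorField.lieBracketWithin ℝ (V Y) (V Z)
          ((chartOne E G).symm ⁻¹' univ ∩ range 𝓘(ℝ, E)) (coordOne E G)) := by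
    intro L hL
    obtain rfl := hL.mfderiv
    rw [GroupLieAlgebra.bracket_def, ← VectorField.mlieBracketWithin_univ]
    exact VectorField.mlieBracketWithin_apply
  rw [e2 _ hasMFDerivAt_chartOne, ContinuousLinearMap.inverse_id, preimage_univ, univ_inter, modelWithCornersSelf_coe, range_id,
    VectorField.lieBracketWithin_univ, ContinuousLinearMap.id_apply, VectorField.lieBracket,
    (hV Y).fderiv_eq, (hV Z).fderiv_eq, hV0 Y, hV0 Z]

/-- The identity `d(Ad) = ad` at `1`, from the local computation applied to multiplication and
conjugation in the chart. Both Chow's theorem and the centrality of the kernel rest on it. -/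
theorem hasMFDerivAt_adj_one [CompleteSpace E] (Z : GroupLieAlgebra 𝓘(ℝ, E) G) :
    ∃ A : E →L[ℝ] E, HasMFDerivAt 𝓘(ℝ, E) 𝓘(ℝ, E) (fun g : G => adj E g Z) 1 A ∧
      ∀ Y : GroupLieAlgebra 𝓘(ℝ, E) G, A Y = (⁅Y, Z⁆ : GroupLieAlgebra 𝓘(ℝ, E) G) := by
  have hM := contDiffAt_inChart (E := E) (G := G) (Φ := fun p => p.1 * p.2)
    (contMDiff_mul 𝓘(ℝ, E) ∞) (by simp)
  have hC := contDiffAt_inChart (E := E) (G := G) (Φ := fun p => p.1 * p.2 * p.1⁻¹)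
    ((contMDiff_fst.mul contMDiff_snd).mul contMDiff_fst.inv) (by simp)
  have ht : ∀ᶠ x in 𝓝 (coordOne E G), x ∈ (chartOne E G).target := chartOne_target_mem_nhds
  have hs : Tendsto (fun p : E × E => (chartOne E G).symm p.1 * (chartOne E G).symm p.2 *
      ((chartOne E G).symm p.1)⁻¹) (𝓝 (coordOne E G, coordOne E G)) (𝓝 1) := by
    have h1 : Tendsto (fun p : E × E => (chartOne E G).symm p.1)
        (𝓝 (coordOne E G, coordOne E G)) (𝓝 1) :=
      tendsto_chartOne_symm.comp (continuous_fst.tendsto (coordOne E G, coordOne E G))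
    have h2 : Tendsto (fun p : E × E => (chartOne E G).symm p.2)
        (𝓝 (coordOne E G, coordOne E G)) (𝓝 1) :=
      tendsto_chartOne_symm.comp (continuous_snd.tendsto (coordOne E G, coordOne E G))
    have : IsTopologicalGroup G := topologicalGroup_of_lieGroup 𝓘(ℝ, E) ∞
    simpa using (h1.mul h2).mul h1.inv
  obtain ⟨A, hA, hAY⟩ := hasFDerivAt_conj_of_local_group (hM.of_le ENat.LEInfty.out)
    (hC.of_le ENat.LEInfty.out)
    (by filter_upwards [ht] with x hx
        simp [(chartOne E G).right_inv hx])
    (by filter_upwards [ht] with x hx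
        simp [(chartOne E G).right_inv hx])
    (by filter_upwards [ht] with x hx
        simp [chartOne_one])
    (by filter_upwards [hs (chartOne_source_mem_nhds (E := E) (G := G))] with p hp
        rw [(chartOne E G).left_inv hp]; simp) Z
  have hq : ∀ g : G, adj E g Z = fderiv ℝ (fun y => chartOne E G
      (g * (chartOne E G).symm y * g⁻¹)) (coordOne E G) Z := by
    intro g
    have h2 := HasMFDerivAt.comp (1 : G) (hasMFDerivAt_congr_point (hasMFDerivAt_chartOne (E := E) (G := G))
      (show 1 = g * 1 * g⁻¹ by simp)) (hasMFDerivAt_conj (E := E) g)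
    exact (congrArg (fun L : E →L[ℝ] E => L Z) (hasMFDerivAt_one_iff.1 h2).2.fderiv).symm
  refine ⟨A, ?_, fun Y => (hAY Y).trans (lie_eq_fderiv_chart Y Z).symm⟩
  have hA' : HasFDerivAt (fun x => adj E ((chartOne E G).symm x) Z) A (coordOne E G) := by
    simpa only [hq] using hA
  refine hasMFDerivAt_one_iff.2 ⟨?_, hA'⟩
  have h1 : ContinuousAt ((fun x => adj E ((chartOne E G).symm x) Z) ∘ (chartOne E G)) 1 :=
    ContinuousAt.comp (by exact hA'.continuousAt) (by exact tendsto_chartOne)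
  refine h1.congr ?_
  filter_upwards [chartOne_source_mem_nhds (E := E) (G := G)] with g hg
  simp [(chartOne E G).left_inv hg]

end LieGroupChart

/-! ### Left-trivialized differentials of real functions. -/

section LeftDerivative

variable {E : Type*} [NormedAddCommGroup E] [NormedSpace ℝ E]
  {G : Type*} [TopologicalSpace G] [ChartedSpace E G] [Group G] [LieGroup 𝓘(ℝ, E) ∞ G]

variable (E) in
/-- The left-trivialized differential of a real function on a Lie group. -/
def leftDiff (φ : G → ℝ) (g : G) : E →L[ℝ] ℝ :=
  mfderiv 𝓘(ℝ, E) 𝓘(ℝ, ℝ) (fun y : G => φ (g * y)) 1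

theorem hasMFDerivAt_leftDiff {φ : G → ℝ} (hφ : ContMDiff 𝓘(ℝ, E) 𝓘(ℝ, ℝ) ∞ φ) (g : G) :
    HasMFDerivAt 𝓘(ℝ, E) 𝓘(ℝ, ℝ) (fun y : G => φ (g * y)) 1 (leftDiff E φ g) :=
  ((hφ.comp (contMDiff_mul_left (a := g))).mdifferentiable (by simp)).mdifferentiableAt.hasMFDerivAt

-- The value at `g` is the tangent map of `(g, y) ↦ φ (g y)` applied to the zero vector at `g`
-- paired with `X` at `1`, which depends smoothly on `g`.
open Bundle in
theorem contMDiff_leftDiff {φ : G → ℝ} (hφ : ContMDiff 𝓘(ℝ, E) 𝓘(ℝ, ℝ) ∞ φ) (X : E) :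
    ContMDiff 𝓘(ℝ, E) 𝓘(ℝ, ℝ) ∞ (fun g => leftDiff E φ g X) := by
  let f : G × G → ℝ := fun p => φ (p.1 * p.2)
  have hf : ContMDiff (𝓘(ℝ, E).prod 𝓘(ℝ, E)) 𝓘(ℝ, ℝ) ∞ f := hφ.comp (contMDiff_mul 𝓘(ℝ, E) ∞)
  let fg : G → TangentBundle 𝓘(ℝ, E) G := fun g => TotalSpace.mk' E g 0
  have sfg : ContMDiff 𝓘(ℝ, E) 𝓘(ℝ, E).tangent ∞ fg := contMDiff_zeroSection _ _
  let fv : G → TangentBundle 𝓘(ℝ, E) G := fun _ => TotalSpace.mk' E 1 X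
  have sfv : ContMDiff 𝓘(ℝ, E) 𝓘(ℝ, E).tangent ∞ fv := contMDiff_const
  have S₁ := sfg.prodMk sfv
  have S₂ := (contMDiff_equivTangentBundleProd_symm (I := 𝓘(ℝ, E)) (M := G) (I' := 𝓘(ℝ, E))
    (M' := G) (n := ∞)).comp S₁
  have S₃ := (hf.contMDiff_tangentMap (m := ∞) (by simp)).comp S₂
  have S₄ := (contMDiff_snd_tangentBundle_modelSpace ℝ 𝓘(ℝ, ℝ) (n := ∞)).comp S₃
  have key : ∀ g : G, leftDiff E φ g X =
      (mfderiv (𝓘(ℝ, E).prod 𝓘(ℝ, E)) 𝓘(ℝ, ℝ) f (g, 1) : E × E →L[ℝ] ℝ) (0, X) := by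
    intro g
    have h := mfderiv_prod_eq_add_apply (I := 𝓘(ℝ, E)) (I' := 𝓘(ℝ, E)) (p := (g, (1 : G)))
      (v := ((0 : E), X)) (hf.mdifferentiableAt (by simp))
    have h0 : (mfderiv 𝓘(ℝ, E) 𝓘(ℝ, ℝ) (fun z : G => f (z, 1)) g : E →L[ℝ] ℝ) 0 = 0 := map_zero _
    refine Eq.trans ?_ h.symm
    refine Eq.trans ?_ (congrArg (fun r : ℝ => r + leftDiff E φ g X) h0).symm
    exact (zero_add _).symm
  exact S₄.congr key

theorem leftDiff_eq_zero_of_notMem_tsupport {φ : G → ℝ} {g : G} (hg : g ∉ tsupport φ) :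
    leftDiff E φ g = 0 := by
  have : IsTopologicalGroup G := topologicalGroup_of_lieGroup 𝓘(ℝ, E) ∞
  have h1 : φ =ᶠ[𝓝 g] 0 := notMem_tsupport_iff_eventuallyEq.1 hg
  have h2 : Tendsto (fun y : G => g * y) (𝓝 1) (𝓝 g) := by
    simpa using (continuous_const_mul g).tendsto (1 : G)
  have h3 : (fun y : G => φ (g * y)) =ᶠ[𝓝 1] fun _ => (0 : ℝ) := h2.eventually h1
  rw [leftDiff, h3.mfderiv_eq]
  exact mfderiv_const

theorem hasCompactSupport_leftDiff [T2Space G] {φ : G → ℝ} (h : HasCompactSupport φ) (X : E) :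
    HasCompactSupport (fun g => leftDiff E φ g X) :=
  h.mono' fun g hg => by
    by_contra hn
    exact hg (by simp [leftDiff_eq_zero_of_notMem_tsupport (E := E) hn])

end LeftDerivative
-- Absolutely continuous functions on an interval.
section AC

/-- The permanence properties below all pass through the description of absolutely continuous
functions as integrals. -/
theorem AbsolutelyContinuousOnInterval.of_eq_integral {f g : ℝ → ℝ} {a b : ℝ}
    (hg : IntervalIntegrable g volume a b)
    (hf : ∀ x ∈ uIcc a b, f x = f a + ∫ t in a..x, g t) :
    AbsolutelyContinuousOnInterval f a b := by
  have h1 := (hg.absolutelyContinuousOnInterval_intervalIntegral (c := a) left_mem_uIcc)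
  rw [absolutelyContinuousOnInterval_iff] at h1 ⊢
  intro ε hε
  obtain ⟨δ, hδ, h⟩ := h1 ε hε
  refine ⟨δ, hδ, fun E hE hs => ?_⟩
  convert h E hE hs using 2 with i hi
  have := hE.1 i hi
  rw [hf _ this.1, hf _ this.2, dist_add_left]

theorem AbsolutelyContinuousOnInterval.eq_integral {f : ℝ → ℝ} {a b : ℝ}
    (hf : AbsolutelyContinuousOnInterval f a b) {x : ℝ} (hx : x ∈ uIcc a b) :
    f x = f a + ∫ t in a..x, deriv f t := by
  rw [(hf.mono (uIcc_subset_uIcc_left hx)).integral_deriv_eq_sub]; ring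

theorem AbsolutelyContinuousOnInterval.congr {f g : ℝ → ℝ} {a b : ℝ}
    (hf : AbsolutelyContinuousOnInterval f a b) (h : EqOn f g (uIcc a b)) :
    AbsolutelyContinuousOnInterval g a b :=
  .of_eq_integral hf.intervalIntegrable_deriv fun x hx => by
    rw [← h hx, ← h left_mem_uIcc, hf.eq_integral hx]

theorem AbsolutelyContinuousOnInterval.trans {f : ℝ → ℝ} {a b c : ℝ}
    (h₁ : AbsolutelyContinuousOnInterval f a b) (h₂ : AbsolutelyContinuousOnInterval f b c) :
    AbsolutelyContinuousOnInterval f a c := by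
  have i₁ := h₁.intervalIntegrable_deriv
  have i₂ := h₂.intervalIntegrable_deriv
  refine .of_eq_integral (i₁.trans i₂) fun x hx => ?_
  have : x ∈ uIcc a b ∨ x ∈ uIcc b c := by
    rw [← mem_union]; exact uIcc_subset_uIcc_union_uIcc hx
  rcases this with h | h
  · exact h₁.eq_integral h
  · rw [← intervalIntegral.integral_add_adjacent_intervals i₁
      (i₂.mono_set (uIcc_subset_uIcc_left h)), ← add_assoc, ← h₁.eq_integral right_mem_uIcc]
    exact h₂.eq_integral h

/-- A negative slope is allowed: reversal of curves needs it. -/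
theorem AbsolutelyContinuousOnInterval.comp_affine {f : ℝ → ℝ} {a c x y : ℝ} (hc : c ≠ 0)
    (hf : AbsolutelyContinuousOnInterval f (a + c * x) (a + c * y)) :
    AbsolutelyContinuousOnInterval (fun t => f (a + c * t)) x y := by
  have hi := hf.intervalIntegrable_deriv
  refine .of_eq_integral (g := fun t => c * deriv f (a + c * t)) ?_ fun t ht => ?_
  · refine IntervalIntegrable.const_mul ?_ _
    have := (hi.comp_add_left a).comp_mul_left (c := c)
    simpa [hc] using this
  · rw [intervalIntegral.integral_const_mul, intervalIntegral.mul_integral_comp_add_mul]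
    refine hf.eq_integral ?_
    rcases le_total x y with h | h <;> rcases le_total 0 c with h' | h' <;>
      have h'' := mul_le_mul_of_nonneg_left h (abs_nonneg c)
    · rw [uIcc_of_le h] at ht
      rw [uIcc_of_le (by rw [abs_of_nonneg h'] at h''; linarith)]
      constructor <;> nlinarith [ht.1, ht.2]
    · rw [uIcc_of_le h] at ht
      rw [uIcc_of_ge (by rw [abs_of_nonpos h'] at h''; linarith)]
      constructor <;> nlinarith [ht.1, ht.2]
    · rw [uIcc_of_ge h] at ht
      rw [uIcc_of_ge (by rw [abs_of_nonneg h'] at h''; linarith)]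
      constructor <;> nlinarith [ht.1, ht.2]
    · rw [uIcc_of_ge h] at ht
      rw [uIcc_of_le (by rw [abs_of_nonpos h'] at h''; linarith)]
      constructor <;> nlinarith [ht.1, ht.2]

end AC

/-! ### Horizontal curves, their lengths, and the invariance and symmetry of the distance. -/

namespace CarnotGroup

variable (G : CarnotGroup.{u})

/-- The model space of a Carnot group. -/
abbrev Coord : Type := EuclideanSpace ℝ (Fin G.dim)

instance : IsTopologicalGroup G := topologicalGroup_of_lieGroup G.model ∞

instance : LocallyCompactSpace G := ChartedSpace.locallyCompactSpace G.Coord G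

theorem algNorm_smul (c : ℝ) (X : G.LieAlg) : G.algNorm (c • X) = |c| * G.algNorm X := by
  simp only [algNorm, map_smul, LinearMap.smul_apply, smul_eq_mul]
  rw [← mul_assoc, Real.sqrt_mul (mul_self_nonneg c), Real.sqrt_mul_self_eq_abs]

theorem algNorm_zero : G.algNorm 0 = 0 := by simp [algNorm]

variable {G}

/-- Left translation is a diffeomorphism, so the formula survives at points of
non-differentiability, where both derivatives take the default value `0`. -/
theorem leftDeriv_eq_mfderiv (γ : ℝ → G) (t : ℝ) :
    G.leftDeriv γ t = (mfderiv 𝓘(ℝ, ℝ) G.model (fun s => (γ t)⁻¹ * γ s) t : ℝ →L[ℝ] G.Coord) 1 := by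
  have hL : MDifferentiableAt G.model G.model (fun x : G => (γ t)⁻¹ * x) (γ t) :=
    (contMDiff_mul_left (n := ∞)).mdifferentiable (by simp) _
  by_cases h : MDifferentiableAt 𝓘(ℝ, ℝ) G.model γ t
  · have := mfderiv_comp t hL h
    exact (congrArg (fun L : ℝ →L[ℝ] G.Coord => L 1) this).symm
  · have h' : ¬ MDifferentiableAt 𝓘(ℝ, ℝ) G.model (fun s => (γ t)⁻¹ * γ s) t := by
      intro hn
      apply h
      have h2 : MDifferentiableAt G.model G.model (fun x : G => γ t * x) ((γ t)⁻¹ * γ t) :=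
        (contMDiff_mul_left (n := ∞)).mdifferentiable (by simp) _
      have h3 := h2.comp t hn
      convert h3 using 1
      ext s; simp
    rw [leftDeriv, mfderiv_zero_of_not_mdifferentiableAt h,
      mfderiv_zero_of_not_mdifferentiableAt h']
    exact map_zero _

theorem leftDeriv_const_mul (a : G) (γ : ℝ → G) (t : ℝ) :
    G.leftDeriv (fun s => a * γ s) t = G.leftDeriv γ t := by
  rw [leftDeriv_eq_mfderiv, leftDeriv_eq_mfderiv]
  have : (fun s => (a * γ t)⁻¹ * (a * γ s)) = fun s => (γ t)⁻¹ * γ s := by ext s; group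
  rw [this]; rfl

theorem leftDeriv_congr {γ γ' : ℝ → G} {t : ℝ} (h : γ =ᶠ[𝓝 t] γ') :
    G.leftDeriv γ t = G.leftDeriv γ' t := by
  rw [leftDeriv_eq_mfderiv, leftDeriv_eq_mfderiv]
  have : (fun s => (γ t)⁻¹ * γ s) =ᶠ[𝓝 t] fun s => (γ' t)⁻¹ * γ' s := by
    filter_upwards [h] with s hs
    rw [hs, h.self_of_nhds]
  rw [this.mfderiv_eq]; rfl

theorem hasMFDerivAt_affine (a c τ : ℝ) : HasMFDerivAt 𝓘(ℝ, ℝ) 𝓘(ℝ, ℝ) (fun τ : ℝ => a + c * τ) τ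
    (ContinuousLinearMap.toSpanSingleton ℝ c) := by
  have : HasDerivAt (fun τ : ℝ => a + c * τ) c τ := by
    simpa using ((hasDerivAt_id τ).const_mul c).const_add a
  exact this.hasFDerivAt.hasMFDerivAt

theorem leftDeriv_comp_affine (γ : ℝ → G) (a : ℝ) {c : ℝ} (hc : c ≠ 0) (τ : ℝ) :
    G.leftDeriv (fun τ => γ (a + c * τ)) τ = c • G.leftDeriv γ (a + c * τ) := by
  rw [leftDeriv_eq_mfderiv, leftDeriv_eq_mfderiv]
  set f : ℝ → G := fun s => (γ (a + c * τ))⁻¹ * γ s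
  by_cases h : MDifferentiableAt 𝓘(ℝ, ℝ) G.model f (a + c * τ)
  · have := (HasMFDerivAt.comp τ h.hasMFDerivAt (hasMFDerivAt_affine a c τ)).mfderiv
    refine (congrArg (fun L : ℝ →L[ℝ] G.Coord => L 1) this).trans ?_
    have h1 : ((mfderiv 𝓘(ℝ, ℝ) G.model f (a + c * τ) : ℝ →L[ℝ] G.Coord)) (c • (1 : ℝ)) =
      c • ((mfderiv 𝓘(ℝ, ℝ) G.model f (a + c * τ) : ℝ →L[ℝ] G.Coord)) (1 : ℝ) := map_smul _ _ _
    refine Eq.trans ?_ h1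
    refine congrArg (mfderiv 𝓘(ℝ, ℝ) G.model f (a + c * τ) : ℝ →L[ℝ] G.Coord) ?_
    show (1 : ℝ) • c = c • (1 : ℝ)
    simp
  · have h' : ¬ MDifferentiableAt 𝓘(ℝ, ℝ) G.model (fun s => f (a + c * s)) τ := by
      intro hn
      apply h
      have e : -a / c + c⁻¹ * (a + c * τ) = τ := by field_simp; ring
      have h3 := MDifferentiableAt.comp (a + c * τ) (by rw [e]; exact hn)
        (hasMFDerivAt_affine (-a / c) c⁻¹ (a + c * τ)).mdifferentiableAt
      convert h3 using 1
      ext s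
      have : a + c * (-a / c + c⁻¹ * s) = s := by field_simp; ring
      simp [this]
    have e1 := mfderiv_zero_of_not_mdifferentiableAt h
    have e2 := mfderiv_zero_of_not_mdifferentiableAt h'
    refine (congrArg (fun L : ℝ →L[ℝ] G.Coord => L 1) e2).trans ?_
    refine Eq.trans ?_ (congrArg (fun L : ℝ →L[ℝ] G.Coord => c • L 1) e1).symm
    exact (smul_zero (A := G.Coord) c).symm

theorem hasDerivAt_comp_curve {φ : G → ℝ} (hφ : ContMDiff G.model 𝓘(ℝ, ℝ) ∞ φ) {γ : ℝ → G} {t : ℝ}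
    (h : MDifferentiableAt 𝓘(ℝ, ℝ) G.model γ t) :
    HasDerivAt (fun s => φ (γ s)) (leftDiff G.Coord φ (γ t) (G.leftDeriv γ t)) t := by
  have hL : MDifferentiableAt G.model G.model (fun x : G => (γ t)⁻¹ * x) (γ t) :=
    (contMDiff_mul_left (n := ∞)).mdifferentiable (by simp) _
  have h1 := (hL.comp t h).hasMFDerivAt
  have h2 := HasMFDerivAt.comp t (hasMFDerivAt_congr_point (hasMFDerivAt_leftDiff hφ (γ t))
    (inv_mul_cancel (γ t)).symm) h1
  have h3 : HasDerivAt _ _ t := HasFDerivAt.hasDerivAt (𝕜 := ℝ) (F := ℝ)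
    (f' := ((leftDiff G.Coord φ (γ t)).comp
      (mfderiv 𝓘(ℝ, ℝ) G.model (fun s => (γ t)⁻¹ * γ s) t : ℝ →L[ℝ] G.Coord)))
    (hasMFDerivAt_iff_hasFDerivAt.1 h2)
  have e : (fun y : G => φ (γ t * y)) ∘ (fun x : G => (γ t)⁻¹ * x) ∘ γ = fun s => φ (γ s) := by
    ext s; simp
  rw [e] at h3
  rw [leftDeriv_eq_mfderiv]
  exact h3

/-- The restriction of a curve to the interval between `a` and `b`, parametrized by `[0,1]`. -/
def _root_.affineRestrict {X : Type*} (γ : ℝ → X) (a b : ℝ) (τ : ℝ) : X := γ (a + (b - a) * τ)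

/-- The length of a curve on a set of parameters. -/
def lengthOn (γ : ℝ → G) (s : Set ℝ) : ℝ≥0∞ :=
  ∫⁻ t in s, ENNReal.ofReal (G.algNorm (G.leftDeriv γ t))

theorem length_eq_lengthOn (γ : ℝ → G) : G.length γ = lengthOn γ (Icc 0 1) := rfl

theorem lengthOn_mono (γ : ℝ → G) {s s' : Set ℝ} (h : s ⊆ s') : lengthOn γ s ≤ lengthOn γ s' :=
  lintegral_mono_set h

theorem image_affine_Icc (a b : ℝ) : (fun τ => a + (b - a) * τ) '' Icc (0 : ℝ) 1 = uIcc a b := by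
  have := segment_eq_image' ℝ a b
  rw [segment_eq_uIcc] at this
  rw [this]
  simp [mul_comm]

/-- Change of variables. The endpoints may come in either order, so this also covers reversed
curves. -/
theorem length_affineRestrict (γ : ℝ → G) {a b : ℝ} (hab : a ≠ b) :
    G.length (affineRestrict γ a b) = lengthOn γ (uIcc a b) := by
  have hc : b - a ≠ 0 := sub_ne_zero.2 hab.symm
  rw [lengthOn, ← image_affine_Icc, lintegral_image_eq_lintegral_abs_deriv_mul measurableSet_Icc
    (f' := fun _ => b - a)
    (fun x _ => by simpa using (((hasDerivAt_id x).const_mul (b - a)).const_add a).hasDerivWithinAt)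
    (fun x _ y _ h => by simpa [hc] using h)]
  refine lintegral_congr fun t => ?_
  rw [← ENNReal.ofReal_mul (abs_nonneg _), ← algNorm_smul, ← leftDeriv_comp_affine _ _ hc]
  rfl

theorem quasiMeasurePreserving_affine (a : ℝ) {c : ℝ} (hc : c ≠ 0) :
    Measure.QuasiMeasurePreserving (fun τ : ℝ => a + c * τ) volume volume :=
  have h1 : Measure.QuasiMeasurePreserving (fun τ : ℝ => a + τ) volume volume :=
    (measurePreserving_add_left volume a).quasiMeasurePreserving
  h1.comp (Measure.quasiMeasurePreserving_smul volume hc)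

theorem isHorizontal_affineRestrict {γ : ℝ → G} (hγ : G.IsHorizontal γ) {a b : ℝ} (hab : a ≠ b)
    (ha : a ∈ Icc (0 : ℝ) 1) (hb : b ∈ Icc (0 : ℝ) 1) :
    G.IsHorizontal (affineRestrict γ a b) := by
  have hc : b - a ≠ 0 := sub_ne_zero.2 hab.symm
  refine ⟨fun φ hφ => ?_, ?_⟩
  · have h1 := (hγ.absolutelyContinuous φ hφ).mono (c := a + (b - a) * 0) (d := a + (b - a) * 1)
      (uIcc_subset_uIcc (by simpa using ha) (by simpa using hb))
    exact AbsolutelyContinuousOnInterval.comp_affine (f := fun t => φ (γ t)) hc h1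
  · have h0 := hγ.horizontal
    rw [ae_restrict_iff' measurableSet_Icc] at h0 ⊢
    filter_upwards [(quasiMeasurePreserving_affine a hc).ae h0] with τ hτ h
    have h2 : a + (b - a) * τ ∈ Icc (0 : ℝ) 1 := by
      constructor <;> nlinarith [h.1, h.2, ha.1, ha.2, hb.1, hb.2]
    have := leftDeriv_comp_affine γ a hc τ
    rw [show affineRestrict γ a b = fun τ => γ (a + (b - a) * τ) from rfl, this]
    exact Submodule.smul_mem _ _ (hτ h2)

theorem isHorizontal_const_mul {γ : ℝ → G} (hγ : G.IsHorizontal γ) (a : G) :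
    G.IsHorizontal (fun t => a * γ t) :=
  ⟨fun φ hφ => hγ.absolutelyContinuous (fun y => φ (a * y)) (hφ.comp contMDiff_mul_left), by
    simpa only [leftDeriv_const_mul] using hγ.horizontal⟩

theorem length_const_mul (γ : ℝ → G) (a : G) : G.length (fun t => a * γ t) = G.length γ := by
  simp only [length, leftDeriv_const_mul]

theorem leftDeriv_const (a : G) (t : ℝ) : G.leftDeriv (fun _ => a) t = 0 := by
  rw [leftDeriv_eq_mfderiv]
  exact congrArg (fun L : ℝ →L[ℝ] G.Coord => L 1) mfderiv_const

theorem isHorizontal_const (a : G) : G.IsHorizontal (fun _ => a) :=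
  ⟨fun φ _ => .of_eq_integral (g := fun _ => 0) (by simp) (by simp), by
    simp [leftDeriv_const]⟩

theorem length_const (a : G) : G.length (fun _ => a) = 0 := by
  simp [length, leftDeriv_const, algNorm_zero]

theorem ccDist_le_length {γ : ℝ → G} (hγ : G.IsHorizontal γ) :
    G.ccDist (γ 0) (γ 1) ≤ G.length γ :=
  iInf₂_le _ ⟨hγ, rfl, rfl⟩

theorem ccDist_self (a : G) : G.ccDist a a = 0 :=
  le_antisymm ((ccDist_le_length (isHorizontal_const a)).trans_eq (length_const a)) zero_le

theorem ccDist_le_lengthOn {γ : ℝ → G} (hγ : G.IsHorizontal γ) {a b : ℝ}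
    (ha : a ∈ Icc (0 : ℝ) 1) (hb : b ∈ Icc (0 : ℝ) 1) :
    G.ccDist (γ a) (γ b) ≤ lengthOn γ (uIcc a b) := by
  rcases eq_or_ne a b with rfl | hab
  · rw [ccDist_self]; exact zero_le
  · have := ccDist_le_length (isHorizontal_affineRestrict hγ hab ha hb)
    rw [length_affineRestrict γ hab] at this
    simpa [affineRestrict] using this

theorem exists_curve_of_ccDist_lt {x y : G} {r : ℝ≥0∞} (h : G.ccDist x y < r) :
    ∃ γ, G.IsHorizontal γ ∧ γ 0 = x ∧ γ 1 = y ∧ G.length γ < r := by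
  simp only [ccDist, iInf_lt_iff] at h
  obtain ⟨γ, ⟨h1, h2, h3⟩, h4⟩ := h
  exact ⟨γ, h1, h2, h3, h4⟩

theorem ccDist_le_of_forall {x y : G} {C : ℝ≥0∞}
    (h : ∀ γ, G.IsHorizontal γ → γ 0 = x → γ 1 = y → C ≤ G.length γ) : C ≤ G.ccDist x y :=
  le_iInf₂ fun γ hγ => h γ hγ.1 hγ.2.1 hγ.2.2

theorem ccDist_mul_left (a x y : G) : G.ccDist (a * x) (a * y) = G.ccDist x y := by
  have key : ∀ (a x y : G), G.ccDist (a * x) (a * y) ≤ G.ccDist x y := fun a x y =>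
    ccDist_le_of_forall fun γ hγ h0 h1 => by
      have := ccDist_le_length (isHorizontal_const_mul hγ a)
      rwa [h0, h1, length_const_mul] at this
  refine le_antisymm (key a x y) ?_
  simpa using key a⁻¹ (a * x) (a * y)

theorem ccDist_comm (x y : G) : G.ccDist x y = G.ccDist y x := by
  have key : ∀ (x y : G), G.ccDist x y ≤ G.ccDist y x := fun x y =>
    ccDist_le_of_forall fun γ hγ h0 h1 => by
      -- Restricting from `1` to `0` reverses the curve.
      have := ccDist_le_lengthOn hγ (a := 1) (b := 0) (by simp) (by simp)
      rw [h0, h1] at this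
      simpa [length_eq_lengthOn] using this
  exact le_antisymm (key _ _) (key _ _)

end CarnotGroup

/-! ### Concatenation, the triangle inequality and regularity of horizontal curves. -/

namespace CarnotGroup

variable {G : CarnotGroup.{u}}

theorem length_congr {γ γ' : ℝ → G} (h : EqOn γ γ' (Ioo 0 1)) : G.length γ = G.length γ' := by
  simp only [length]
  rw [← setLIntegral_congr (Ioo_ae_eq_Icc (a := (0 : ℝ)) (b := 1)),
    ← setLIntegral_congr (Ioo_ae_eq_Icc (a := (0 : ℝ)) (b := 1))]
  refine setLIntegral_congr_fun measurableSet_Ioo fun t ht => ?_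
  have : γ =ᶠ[𝓝 t] γ' := h.eventuallyEq_of_mem (isOpen_Ioo.mem_nhds ht)
  simp only [leftDeriv_congr this]

/-- The concatenation of two curves parametrized by `[0,1]`. -/
def concat (γ₁ γ₂ : ℝ → G) (t : ℝ) : G := if t ≤ 1 / 2 then γ₁ (2 * t) else γ₂ (2 * t - 1)

theorem length_concat_le (γ₁ γ₂ : ℝ → G) :
    G.length (concat γ₁ γ₂) ≤ G.length γ₁ + G.length γ₂ := by
  have h1 : G.length γ₁ = lengthOn (concat γ₁ γ₂) (uIcc 0 (1 / 2)) := by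
    rw [← length_affineRestrict _ (by norm_num)]
    refine length_congr fun t ht => ?_
    simp only [affineRestrict, concat]
    rw [if_pos (by linarith [ht.2])]
    congr 1; ring
  have h2 : G.length γ₂ = lengthOn (concat γ₁ γ₂) (uIcc (1 / 2) 1) := by
    rw [← length_affineRestrict _ (by norm_num)]
    refine length_congr fun t ht => ?_
    simp only [affineRestrict, concat]
    rw [if_neg (by linarith [ht.1])]
    congr 1; ring
  rw [h1, h2, length_eq_lengthOn, uIcc_of_le (by norm_num), uIcc_of_le (by norm_num),
    ← Icc_union_Icc_eq_Icc (show (0 : ℝ) ≤ 1 / 2 by norm_num) (by norm_num)]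
  exact lintegral_union_le _ _ _

theorem isHorizontal_concat {γ₁ γ₂ : ℝ → G} (h₁ : G.IsHorizontal γ₁) (h₂ : G.IsHorizontal γ₂)
    (h : γ₁ 1 = γ₂ 0) : G.IsHorizontal (concat γ₁ γ₂) := by
  refine ⟨fun φ hφ => ?_, ?_⟩
  · have a1 := h₁.absolutelyContinuous φ hφ
    have a2 := h₂.absolutelyContinuous φ hφ
    have b1 : AbsolutelyContinuousOnInterval (fun t => φ (γ₁ (0 + 2 * t))) 0 (1 / 2) :=
      AbsolutelyContinuousOnInterval.comp_affine (f := fun t => φ (γ₁ t)) two_ne_zero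
        (by norm_num; exact a1)
    have b2 : AbsolutelyContinuousOnInterval (fun t => φ (γ₂ (-1 + 2 * t))) (1 / 2) 1 :=
      AbsolutelyContinuousOnInterval.comp_affine (f := fun t => φ (γ₂ t)) two_ne_zero
        (by norm_num; exact a2)
    refine (b1.congr fun t ht => ?_).trans (b2.congr fun t ht => ?_)
    · rw [uIcc_of_le (by norm_num)] at ht
      simp only [concat]
      rw [if_pos ht.2, zero_add]
    · rw [uIcc_of_le (by norm_num)] at ht
      rcases ht.1.eq_or_lt with rfl | h'
      · simp [concat, h]
      · simp only [concat]
        rw [if_neg h'.not_ge, sub_eq_neg_add]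
  · have a1 := h₁.horizontal
    have a2 := h₂.horizontal
    rw [ae_restrict_iff' measurableSet_Icc] at a1 a2 ⊢
    have hne : ∀ᵐ t : ℝ, t ≠ 1 / 2 := by simp [ae_iff, measure_singleton]
    filter_upwards [(quasiMeasurePreserving_affine 0 two_ne_zero).ae a1,
      (quasiMeasurePreserving_affine (-1) two_ne_zero).ae a2, hne] with t t1 t2 t3 ht
    rcases lt_or_gt_of_ne t3 with h' | h'
    · have e : concat γ₁ γ₂ =ᶠ[𝓝 t] fun t => γ₁ (0 + 2 * t) := by
        filter_upwards [Iio_mem_nhds h'] with s hs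
        simp only [concat]
        rw [if_pos (le_of_lt (mem_Iio.1 hs)), zero_add]
      rw [leftDeriv_congr e, leftDeriv_comp_affine _ _ two_ne_zero]
      exact Submodule.smul_mem _ _ (t1 ⟨by linarith [ht.1], by linarith⟩)
    · have e : concat γ₁ γ₂ =ᶠ[𝓝 t] fun t => γ₂ (-1 + 2 * t) := by
        filter_upwards [Ioi_mem_nhds h'] with s hs
        simp only [concat]
        rw [if_neg (not_le.2 hs), sub_eq_neg_add]
      rw [leftDeriv_congr e, leftDeriv_comp_affine _ _ two_ne_zero]
      exact Submodule.smul_mem _ _ (t2 ⟨by linarith, by linarith [ht.2]⟩)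

theorem ccDist_triangle (x y z : G) : G.ccDist x z ≤ G.ccDist x y + G.ccDist y z := by
  refine ENNReal.le_of_forall_pos_le_add fun ε hε hfin => ?_
  have hε2 : (0 : ℝ≥0∞) < ε / 2 := ENNReal.half_pos (by exact_mod_cast hε.ne')
  obtain ⟨hx, hy⟩ := ENNReal.add_lt_top.1 hfin
  obtain ⟨γ₁, h1, h10, h11, h1l⟩ := exists_curve_of_ccDist_lt (ENNReal.lt_add_right hx.ne hε2.ne')
  obtain ⟨γ₂, h2, h20, h21, h2l⟩ := exists_curve_of_ccDist_lt (ENNReal.lt_add_right hy.ne hε2.ne')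
  have h := ccDist_le_length (isHorizontal_concat h1 h2 (h11.trans h20.symm))
  have e0 : concat γ₁ γ₂ 0 = x := by simp [concat, h10]
  have e1 : concat γ₁ γ₂ 1 = z := by
    simp only [concat]; rw [if_neg (by norm_num)]; norm_num; exact h21
  rw [e0, e1] at h
  calc G.ccDist x z ≤ G.length γ₁ + G.length γ₂ := h.trans (length_concat_le _ _)
    _ ≤ (G.ccDist x y + ε / 2) + (G.ccDist y z + ε / 2) := by gcongr
    _ = _ := by rw [add_add_add_comm, ENNReal.add_halves]

/-- Supports of bump functions form a neighbourhood basis, and a bump function along the curve is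
continuous, so it stays non-zero near a point where it is `1`. -/
theorem IsHorizontal.continuousOn {γ : ℝ → G} (hγ : G.IsHorizontal γ) :
    ContinuousOn γ (Icc 0 1) := by
  intro t ht U hU
  obtain ⟨f, hf, hfU⟩ := (SmoothBumpFunction.nhds_basis_support (I := G.model) hU).mem_iff.1 hU
  have hc := (hγ.absolutelyContinuous f f.contMDiff).continuousOn
  rw [uIcc_of_le zero_le_one] at hc
  have h1 := (hc t ht).eventually (isOpen_ne.mem_nhds (show f (γ t) ≠ 0 by simp))
  exact h1.mono fun s hs => hfU hs

/-- Near each time the curve lies in one chart, where its coordinates are absolutely continuous and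
so differentiable almost everywhere; exceptional sets that are locally null are null. -/
theorem IsHorizontal.ae_mdifferentiableAt {γ : ℝ → G} (hγ : G.IsHorizontal γ) :
    ∀ᵐ t ∂(volume.restrict (Icc (0 : ℝ) 1)), MDifferentiableAt 𝓘(ℝ, ℝ) G.model γ t := by
  rw [← restrict_Ioo_eq_restrict_Icc, ae_restrict_iff' measurableSet_Ioo, ae_iff]
  push Not
  refine measure_null_of_locally_null _ fun t₀ ht₀ => ?_
  obtain ⟨f, -⟩ := (SmoothBumpFunction.nhds_basis_support (I := G.model) (c := γ t₀)
    univ_mem).ex_mem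
  have hcont : ∀ t ∈ Ioo (0 : ℝ) 1, ContinuousAt γ t := fun t ht =>
    hγ.continuousOn.continuousAt (Icc_mem_nhds ht.1 ht.2)
  -- Absolute continuity is tested only against globally smooth functions, hence the cut-off.
  let φ : Fin G.dim → G → ℝ := fun i x => f x • (extChartAt G.model (γ t₀) x) i
  have hφ : ∀ i, ContMDiff G.model 𝓘(ℝ, ℝ) ∞ (φ i) := by
    intro i
    refine f.contMDiff_smul ?_
    have h1 := contMDiffOn_extChartAt (I := G.model) (n := ∞) (x := γ t₀)
    have h2 : ContMDiff 𝓘(ℝ, G.Coord) 𝓘(ℝ, ℝ) ∞ (fun y : G.Coord => y i) :=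
      (EuclideanSpace.proj (𝕜 := ℝ) i).contDiff.contMDiff
    exact h2.comp_contMDiffOn h1
  obtain ⟨O, hO1, hO2, hO3⟩ := eventually_nhds_iff.1 (f.eventuallyEq_one.and
    ((chartAt G.Coord (γ t₀)).open_source.mem_nhds (mem_chart_source _ (γ t₀))))
  have hae : ∀ᵐ t : ℝ, ∀ i, t ∈ uIcc (0 : ℝ) 1 → DifferentiableAt ℝ (fun s => φ i (γ s)) t :=
    ae_all_iff.2 fun i => (hγ.absolutelyContinuous _ (hφ i)).ae_differentiableAt
  refine ⟨_, inter_mem_nhdsWithin _ ((hcont t₀ ht₀.1).preimage_mem_nhds (hO2.mem_nhds hO3)), ?_⟩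
  refine measure_mono_null (t := {t | ¬ ∀ i, t ∈ uIcc (0 : ℝ) 1 →
    DifferentiableAt ℝ (fun s => φ i (γ s)) t}) (fun t ht => ?_) (ae_iff.1 hae)
  refine fun hd => ?_
  obtain ⟨⟨ht1, ht2⟩, htO⟩ := ht
  refine ht2 ?_
  have hO : ∀ᶠ s in 𝓝 t, γ s ∈ O := (hcont t ht1).preimage_mem_nhds (hO2.mem_nhds htO)
  have hd' : DifferentiableAt ℝ (fun s => extChartAt G.model (γ t₀) (γ s)) t := by
    rw [differentiableAt_euclidean]
    intro i
    refine (hd i ?_).congr_of_eventuallyEq ?_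
    · rw [uIcc_of_le zero_le_one]; exact Ioo_subset_Icc_self ht1
    · filter_upwards [hO] with s hs
      have : f (γ s) = 1 := (hO1 _ hs).1
      simp [φ, this]
  have hsrc : γ t ∈ (extChartAt G.model (γ t₀)).source := by
    rw [extChartAt_source]; exact (hO1 _ htO).2
  have h3 : MDifferentiableAt 𝓘(ℝ, G.Coord) G.model (extChartAt G.model (γ t₀)).symm
      (extChartAt G.model (γ t₀) (γ t)) :=
    ((contMDiffOn_extChartAt_symm (I := G.model) (n := ∞) (γ t₀)).contMDiffAt
      (extChartAt_target_mem_nhds' ((extChartAt G.model (γ t₀)).map_source hsrc))).mdifferentiableAt (by simp)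
  have h4 := h3.comp t hd'.mdifferentiableAt
  refine h4.congr_of_eventuallyEq ?_
  filter_upwards [hO] with s hs
  have : γ s ∈ (extChartAt G.model (γ t₀)).source := by
    rw [extChartAt_source]; exact (hO1 _ hs).2
  exact ((extChartAt G.model (γ t₀)).left_inv this).symm

end CarnotGroup

/-! ### Estimates of smooth functions by the distance. -/

namespace CarnotGroup

variable {G : CarnotGroup.{u}}

instance : FiniteDimensional ℝ G.LieAlg := inferInstanceAs (FiniteDimensional ℝ G.Coord)

theorem algNorm_nonneg (X : G.LieAlg) : 0 ≤ G.algNorm X := Real.sqrt_nonneg _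

theorem ip_self_nonneg (X : G.LieAlg) : 0 ≤ G.ip X X := by
  rcases eq_or_ne X 0 with rfl | h
  · simp
  · exact (G.ip_pos X h).le

theorem abs_ip_le (X Y : G.LieAlg) : |G.ip X Y| ≤ G.algNorm X * G.algNorm Y := by
  have h : (G.ip X Y) ^ 2 ≤ G.ip X X * G.ip Y Y :=
    LinearMap.BilinForm.apply_sq_le_of_symm G.ip ip_self_nonneg ⟨G.ip_symm⟩ X Y
  rw [algNorm, algNorm, ← Real.sqrt_mul (ip_self_nonneg X), ← Real.sqrt_sq_eq_abs]
  exact Real.sqrt_le_sqrt h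

/-- By nondegeneracy `l` is the inner product with some `W`; Cauchy–Schwarz gives the constant
`‖W‖`. -/
theorem exists_abs_le_algNorm (l : G.LieAlg →ₗ[ℝ] ℝ) :
    ∃ C : ℝ≥0, ∀ X, |l X| ≤ C * G.algNorm X := by
  have hinj : Function.Injective G.ip := by
    rw [injective_iff_map_eq_zero]
    intro X hX
    by_contra h
    exact (G.ip_pos X h).ne' (by rw [hX]; rfl)
  have hsurj : Function.Surjective G.ip :=
    (LinearMap.injective_iff_surjective_of_finrank_eq_finrank
      (Subspace.dual_finrank_eq (K := ℝ) (V := G.LieAlg)).symm).1 hinj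
  obtain ⟨W, rfl⟩ := hsurj l
  exact ⟨⟨G.algNorm W, algNorm_nonneg W⟩, fun X => abs_ip_le W X⟩

/-- A linear form on the first layer is controlled by its values on finitely many horizontal
vectors. -/
theorem exists_horizontal_frame (G : CarnotGroup.{u}) :
    ∃ (n : ℕ) (b : Fin n → G.LieAlg) (C : Fin n → ℝ≥0), (∀ i, b i ∈ G.layer 1) ∧
      ∀ (L : G.LieAlg →ₗ[ℝ] ℝ), ∀ X ∈ G.layer 1,
        |L X| ≤ (∑ i, C i * |L (b i)|) * G.algNorm X := by
  let B := Module.finBasis ℝ (G.layer 1)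
  have h : ∀ i, ∃ C : ℝ≥0, ∀ X : G.layer 1, |B.coord i X| ≤ C * G.algNorm X := by
    intro i
    obtain ⟨l, hl⟩ := (B.coord i).exists_extend
    obtain ⟨C, hC⟩ := exists_abs_le_algNorm l
    refine ⟨C, fun X => ?_⟩
    rw [← hl]
    exact hC X
  choose C hC using h
  refine ⟨_, fun i => (B i : G.LieAlg), C, fun i => (B i).2, fun L X hX => ?_⟩
  have e : L X = ∑ i, B.coord i ⟨X, hX⟩ * L (B i) := by
    have := congrArg (fun Y : G.layer 1 => L Y) (B.sum_repr ⟨X, hX⟩)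
    simp only at this
    rw [← this, Submodule.coe_sum, map_sum]
    refine Finset.sum_congr rfl fun i _ => ?_
    rw [Submodule.coe_smul, map_smul]
    rfl
  rw [e, Finset.sum_mul]
  refine (Finset.abs_sum_le_sum_abs _ _).trans (Finset.sum_le_sum fun i _ => ?_)
  rw [abs_mul]
  have := mul_le_mul_of_nonneg_right (hC i ⟨X, hX⟩) (abs_nonneg (L (B i)))
  linarith

/-- The fundamental theorem of calculus along the curve: only horizontal directions contribute,
because the left-trivialized velocity is almost everywhere in the first layer. -/
theorem abs_sub_le_of_leftDiff_le {φ : G → ℝ} (hφ : ContMDiff G.model 𝓘(ℝ, ℝ) ∞ φ) {γ : ℝ → G}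
    (hγ : G.IsHorizontal γ) {K : ℝ≥0} (hK : ∀ t ∈ Icc (0 : ℝ) 1, ∀ X : G.LieAlg, X ∈ G.layer 1 →
      |leftDiff G.Coord φ (γ t) X| ≤ K * G.algNorm X) :
    ENNReal.ofReal |φ (γ 1) - φ (γ 0)| ≤ K * G.length γ := by
  have hac := hγ.absolutelyContinuous φ hφ
  rw [← hac.integral_deriv_eq_sub, intervalIntegral.integral_of_le zero_le_one,
    ← integral_Icc_eq_integral_Ioc, ← Real.norm_eq_abs, ofReal_norm]
  refine (enorm_integral_le_lintegral_enorm _).trans ?_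
  rw [length, ← lintegral_const_mul' _ _ ENNReal.coe_ne_top]
  refine lintegral_mono_ae ?_
  filter_upwards [hγ.horizontal, hγ.ae_mdifferentiableAt, ae_restrict_mem measurableSet_Icc]
    with t h1 h2 h3
  rw [(hasDerivAt_comp_curve hφ h2).deriv, ← ofReal_norm, Real.norm_eq_abs,
    ← ENNReal.ofReal_coe_nnreal]
  exact (ENNReal.ofReal_le_ofReal (hK t h3 _ h1)).trans_eq (ENNReal.ofReal_mul K.2)

theorem _root_.ENNReal.le_mul_pow_of_forall_lt {A d : ℝ≥0∞} {C : ℝ≥0} (n : ℕ) (hd : d ≠ ⊤)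
    (h : ∀ r, d < r → r ≠ ⊤ → A ≤ C * r ^ n) : A ≤ C * d ^ n := by
  have hc : Continuous fun r : ℝ≥0∞ => (C : ℝ≥0∞) * r ^ n :=
    (ENNReal.continuous_const_mul ENNReal.coe_ne_top).comp (ENNReal.continuous_pow n)
  have : (𝓝[Ioi d] d).NeBot := nhdsGT_neBot_of_exists_gt ⟨⊤, hd.lt_top⟩
  refine ge_of_tendsto (x := 𝓝[Ioi d] d) ((hc.tendsto d).mono_left nhdsWithin_le_nhds) ?_
  filter_upwards [self_mem_nhdsWithin, nhdsWithin_le_nhds (Iio_mem_nhds hd.lt_top)] with r hr hr'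
  exact h r hr (ne_of_lt hr')

theorem exists_lipschitz {φ : G → ℝ} (hφ : ContMDiff G.model 𝓘(ℝ, ℝ) ∞ φ)
    (hc : HasCompactSupport φ) :
    ∃ C : ℝ≥0, ∀ x y, ENNReal.ofReal |φ y - φ x| ≤ C * G.ccDist x y := by
  obtain ⟨n, b, C, -, hC⟩ := exists_horizontal_frame G
  have h : ∀ i, ∃ M : ℝ≥0, ∀ g : G, |leftDiff G.Coord φ g (b i)| ≤ M := by
    intro i
    obtain ⟨M, hM⟩ := (hasCompactSupport_leftDiff (E := G.Coord) hc (b i)).exists_bound_of_continuous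
      (contMDiff_leftDiff (E := G.Coord) hφ (b i)).continuous
    exact ⟨M.toNNReal, fun g => (hM g).trans (Real.le_coe_toNNReal M)⟩
  choose M hM using h
  -- The summand `1` keeps the constant non-zero, so that the bound also holds at distance `⊤`.
  refine ⟨∑ i, C i * M i + 1, fun x y => ?_⟩
  rcases eq_or_ne (G.ccDist x y) ⊤ with h0 | h0
  · rw [h0, ENNReal.mul_top (by simp)]; exact le_top
  have := ENNReal.le_mul_pow_of_forall_lt (A := ENNReal.ofReal |φ y - φ x|)
    (C := ∑ i, C i * M i + 1) 1 h0 fun r hr _ => ?_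
  · simpa using this
  obtain ⟨γ, hγ, rfl, rfl, hl⟩ := exists_curve_of_ccDist_lt hr
  refine (abs_sub_le_of_leftDiff_le hφ hγ (K := ∑ i, C i * M i + 1) fun t _ X hX => ?_).trans ?_
  · refine (hC (leftDiff G.Coord φ (γ t)).toLinearMap X hX).trans
      (mul_le_mul_of_nonneg_right ?_ (algNorm_nonneg X))
    push_cast
    refine le_add_of_le_of_nonneg (Finset.sum_le_sum fun i _ => ?_) zero_le_one
    exact mul_le_mul_of_nonneg_left (hM i _) (C i).2
  · rw [pow_one]; gcongr

/-- The horizontal derivatives of `φ` are Lipschitz and vanish at `1`, so they are `O(r)` along a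
curve of length less than `r` that starts at `1`; integrating over that curve gives `O(r²)`. -/
theorem exists_sq_bound {φ : G → ℝ} (hφ : ContMDiff G.model 𝓘(ℝ, ℝ) ∞ φ)
    (hc : HasCompactSupport φ) (h1 : ∀ X : G.LieAlg, X ∈ G.layer 1 → leftDiff G.Coord φ 1 X = 0) :
    ∃ C : ℝ≥0, ∀ g, G.ccDist 1 g ≠ ⊤ → ENNReal.ofReal |φ g - φ 1| ≤ C * G.ccDist 1 g ^ 2 := by
  obtain ⟨n, b, C, hb, hC⟩ := exists_horizontal_frame G
  have h : ∀ i, ∃ M : ℝ≥0, ∀ x y : G, ENNReal.ofReal |leftDiff G.Coord φ y (b i) -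
      leftDiff G.Coord φ x (b i)| ≤ M * G.ccDist x y := fun i =>
    exists_lipschitz (contMDiff_leftDiff (E := G.Coord) hφ (b i))
      (hasCompactSupport_leftDiff (E := G.Coord) hc (b i))
  choose M hM using h
  refine ⟨∑ i, C i * M i, fun g hg => ENNReal.le_mul_pow_of_forall_lt 2 hg fun r hr hr' => ?_⟩
  lift r to ℝ≥0 using hr'
  obtain ⟨γ, hγ, h0, rfl, hl⟩ := exists_curve_of_ccDist_lt hr
  have := abs_sub_le_of_leftDiff_le hφ hγ (K := (∑ i, C i * M i) * r) fun t ht X hX => ?_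
  · rw [h0] at this
    refine this.trans ?_
    rw [pow_two, ENNReal.coe_mul, mul_assoc]
    gcongr
  · refine (hC (leftDiff G.Coord φ (γ t)).toLinearMap X hX).trans
      (mul_le_mul_of_nonneg_right ?_ (algNorm_nonneg X))
    rw [Finset.sum_mul]
    push_cast
    refine Finset.sum_le_sum fun i _ => ?_
    rw [mul_assoc]
    refine mul_le_mul_of_nonneg_left ?_ (C i).2
    have h2 := hM i 1 (γ t)
    rw [h1 _ (hb i), sub_zero] at h2
    have h3 : G.ccDist 1 (γ t) ≤ r := by
      have := ccDist_le_lengthOn hγ (a := 0) (b := t) (by simp) ht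
      rw [h0] at this
      refine this.trans ((lengthOn_mono γ ?_).trans hl.le)
      rw [uIcc_of_le ht.1]
      exact Icc_subset_Icc_right ht.2
    have h4 : ENNReal.ofReal |leftDiff G.Coord φ (γ t) (b i)| ≤ ((M i * r : ℝ≥0) : ℝ≥0∞) := by
      rw [ENNReal.coe_mul]
      exact h2.trans (by gcongr)
    have h5 := (ENNReal.ofReal_le_iff_le_toReal ENNReal.coe_ne_top).1 h4
    exact h5.trans_eq (by simp)

/-- A bump function supported in `U` is Lipschitz and drops from `1` to `0` on the way out of `U`,
which costs a definite distance. The converse comparison of topologies is Chow's theorem. -/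
theorem exists_ccDist_lt_subset {U : Set G} (hU : U ∈ 𝓝 (1 : G)) :
    ∃ ε : ℝ≥0, 0 < ε ∧ ∀ g, G.ccDist 1 g < ε → g ∈ U := by
  obtain ⟨f, hf, hfU⟩ := (SmoothBumpFunction.nhds_basis_support (I := G.model) hU).mem_iff.1 hU
  obtain ⟨C, hC⟩ := exists_lipschitz f.contMDiff f.hasCompactSupport
  refine ⟨(C + 1)⁻¹, by positivity, fun g hg => hfU fun h0 => ?_⟩
  have h := hC 1 g
  rw [h0, f.eq_one] at h
  have h2 : (C : ℝ≥0∞) * G.ccDist 1 g ≤ ((C * (C + 1)⁻¹ : ℝ≥0) : ℝ≥0∞) := by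
    rw [ENNReal.coe_mul]; gcongr
  have h3 : C * (C + 1)⁻¹ < 1 := by
    rw [← div_eq_mul_inv, div_lt_one (by positivity)]
    exact lt_add_one C
  have h4 := h.trans h2
  rw [zero_sub, abs_neg, abs_one, ENNReal.ofReal_one] at h4
  exact h3.not_ge (ENNReal.coe_le_coe.1 (by simpa only [ENNReal.coe_one] using h4))

end CarnotGroup

/-! ### Constancy from an exponent greater than one. -/

namespace CarnotGroup

variable {G : CarnotGroup.{u}}

theorem lengthOn_Ioc (γ : ℝ → G) (s t : ℝ) : lengthOn γ (Ioc s t) = lengthOn γ (Icc s t) :=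
  setLIntegral_congr Ioc_ae_eq_Icc

/-- A map along a rectifiable curve whose increments are controlled by a power greater than one of
the length has equal values at the endpoints. -/
theorem eq_of_edist_le_length_rpow {X : Type*} [EMetricSpace X] {γ : ℝ → G}
    (hγ : G.length γ ≠ ⊤) {f : ℝ → X} {α : ℝ} (hα : 1 < α) {K : ℝ≥0} {ε : ℝ≥0∞} (hε : 0 < ε)
    (hf : ∀ s ∈ Icc (0 : ℝ) 1, ∀ t ∈ Icc (0 : ℝ) 1, s ≤ t → lengthOn γ (Icc s t) < ε →
      edist (f s) (f t) ≤ K * lengthOn γ (Icc s t) ^ α) : f 0 = f 1 := by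
  have key : ∀ δ : ℝ≥0∞, 0 < δ → δ < ε →
      edist (f 0) (f 1) ≤ K * (G.length γ * δ ^ (α - 1)) := by
    intro δ hδ hδε
    -- Absolute continuity of the length integral: sufficiently many equal subintervals each carry
    -- length less than `δ`.
    obtain ⟨η, hη, hηδ⟩ := exists_pos_setLIntegral_lt_of_measure_lt
      (μ := volume.restrict (Icc (0 : ℝ) 1))
      (f := fun t => ENNReal.ofReal (G.algNorm (G.leftDeriv γ t))) hγ hδ.ne'
    obtain ⟨n, hn⟩ := ENNReal.exists_inv_nat_lt hη.ne'
    have hn0 : n ≠ 0 := by rintro rfl; simp at hn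
    have hnpos : (0 : ℝ) < n := by positivity
    let p : ℕ → ℝ := fun i => i / n
    have hp : ∀ i ≤ n, p i ∈ Icc (0 : ℝ) 1 := fun i hi =>
      ⟨by positivity, (div_le_one hnpos).2 (by exact_mod_cast hi)⟩
    have hps : ∀ i, p (i + 1) - p i = (n : ℝ)⁻¹ := fun i => by
      simp only [p]; push_cast; field_simp; ring
    have hpm : ∀ i, p i ≤ p (i + 1) := fun i => by
      have := hps i; have : (0 : ℝ) < (n : ℝ)⁻¹ := by positivity
      linarith
    have hsmall : ∀ i < n, lengthOn γ (Icc (p i) (p (i + 1))) < δ := by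
      intro i hi
      have h1 := hηδ (Icc (p i) (p (i + 1))) ?_
      · rw [Measure.restrict_restrict measurableSet_Icc, inter_eq_left.2
          (Icc_subset_Icc (hp i hi.le).1 (hp (i + 1) hi).2)] at h1
        exact h1
      · refine (Measure.restrict_apply_le _ _).trans_lt ?_
        rw [Real.volume_Icc, hps, ENNReal.ofReal_inv_of_pos hnpos, ENNReal.ofReal_natCast]
        exact hn
    have hsum : ∀ k, ∑ i ∈ Finset.range k, lengthOn γ (Icc (p i) (p (i + 1))) =
        lengthOn γ (Icc (p 0) (p k)) := by
      intro k
      induction k with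
      | zero => simp [lengthOn]
      | succ k ih =>
        have h0k : p 0 ≤ p k := by simp only [p]; gcongr; exact Nat.zero_le _
        rw [Finset.sum_range_succ, ih, ← lengthOn_Ioc, ← lengthOn_Ioc, ← lengthOn_Ioc,
          ← Ioc_union_Ioc_eq_Ioc h0k (hpm k)]
        exact (lintegral_union measurableSet_Ioc
          (disjoint_left.2 fun x hx hx' => hx.2.not_gt hx'.1)).symm
    have h0 : p 0 = 0 := by simp [p]
    have h1 : p n = 1 := by simp [p, hn0]
    calc edist (f 0) (f 1) = edist (f (p 0)) (f (p n)) := by rw [h0, h1]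
      _ ≤ ∑ i ∈ Finset.range n, edist (f (p i)) (f (p (i + 1))) :=
        edist_le_range_sum_edist (fun i => f (p i)) n
      _ ≤ ∑ i ∈ Finset.range n, K * (lengthOn γ (Icc (p i) (p (i + 1))) * δ ^ (α - 1)) := by
        refine Finset.sum_le_sum fun i hi => ?_
        have hi' := Finset.mem_range.1 hi
        refine (hf _ (hp i hi'.le) _ (hp (i + 1) hi') (hpm i) ((hsmall i hi').trans hδε)).trans ?_
        gcongr
        -- One factor sums to the total length; the other is at most `δ ^ (α - 1)` and tends to `0`
        -- with `δ`.
        have e : ∀ a : ℝ≥0∞, a ^ α = a * a ^ (α - 1) := fun a => by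
          conv_lhs => rw [show α = 1 + (α - 1) by ring]
          rw [ENNReal.rpow_add_of_nonneg _ _ zero_le_one (by linarith), ENNReal.rpow_one]
        rw [e]
        gcongr
        exact (hsmall i hi').le
      _ = K * (G.length γ * δ ^ (α - 1)) := by
        rw [← Finset.mul_sum, ← Finset.sum_mul, hsum, h0, h1]; rfl
  have hlim : Tendsto (fun δ : ℝ≥0∞ => K * (G.length γ * δ ^ (α - 1))) (𝓝[Ioi 0] 0)
      (𝓝 (K * (G.length γ * 0 ^ (α - 1)))) := by
    have h1 : Continuous fun δ : ℝ≥0∞ => K * (G.length γ * δ ^ (α - 1)) :=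
      (ENNReal.continuous_const_mul ENNReal.coe_ne_top).comp
        ((ENNReal.continuous_const_mul hγ).comp ENNReal.continuous_rpow_const)
    exact (h1.tendsto 0).mono_left nhdsWithin_le_nhds
  have hn : (𝓝[Ioi 0] (0 : ℝ≥0∞)).NeBot := nhdsGT_neBot_of_exists_gt ⟨⊤, ENNReal.zero_lt_top⟩
  have := ge_of_tendsto (x := 𝓝[Ioi 0] (0 : ℝ≥0∞)) hlim (b := edist (f 0) (f 1)) (by
    filter_upwards [self_mem_nhdsWithin, nhdsWithin_le_nhds (Iio_mem_nhds hε)] with δ h1 h2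
    exact key δ h1 h2)
  rw [ENNReal.zero_rpow_of_pos (by linarith), mul_zero, mul_zero] at this
  exact edist_le_zero.1 this

end CarnotGroup

/-! ### Local integral curves of left-invariant fields. -/

namespace CarnotGroup

variable {G : CarnotGroup.{u}}

/-- A local integral curve, starting at the identity, of a left-invariant vector field. -/
structure IsLocalExp (e : ℝ → G) (X : G.LieAlg) : Prop where
  map_zero : e 0 = 1
  eventually : ∀ᶠ t in 𝓝 (0 : ℝ), MDifferentiableAt 𝓘(ℝ, ℝ) G.model e t ∧ G.leftDeriv e t = X

theorem mfderiv_inv_mul_mulInvariantVectorField (X : G.LieAlg) (g : G) :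
    (mfderiv G.model G.model (fun x : G => g⁻¹ * x) g : G.Coord →L[ℝ] G.Coord)
      (mulInvariantVectorField X g) = X := by
  have h1 : HasMFDerivAt G.model G.model (fun x : G => g⁻¹ * x) g
      (mfderiv G.model G.model (fun x : G => g⁻¹ * x) g) :=
    ((contMDiff_mul_left (n := ∞)).mdifferentiable (by simp) _).hasMFDerivAt
  have h2 : HasMFDerivAt G.model G.model (fun x : G => g * x) 1
      (mfderiv G.model G.model (fun x : G => g * x) 1) :=
    ((contMDiff_mul_left (n := ∞)).mdifferentiable (by simp) _).hasMFDerivAt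
  have h3 := HasMFDerivAt.comp (1 : G) (hasMFDerivAt_congr_point h1 (mul_one g).symm) h2
  have e : (fun x : G => g⁻¹ * x) ∘ (fun x : G => g * x) = id := by ext; simp
  rw [e] at h3
  exact congrArg (fun L : G.Coord →L[ℝ] G.Coord => L X) (hasMFDerivAt_unique h3 (hasMFDerivAt_id 1))

theorem exists_isLocalExp (X : G.LieAlg) : ∃ e : ℝ → G, IsLocalExp e X := by
  have : LieGroup G.model (minSmoothness ℝ 3) G := by
    rw [minSmoothness_of_isRCLikeNormedField]; infer_instance
  have : IsManifold G.model 1 G := IsManifold.of_le (n := ∞) (by norm_num)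
  have hv := (contMDiffAt_mulInvariantVectorField (I := G.model) (G := G) X (g := 1)).of_le
    (m := 1) (by rw [minSmoothness_of_isRCLikeNormedField]; norm_num)
  obtain ⟨e, h0, he⟩ := exists_isMIntegralCurveAt_of_contMDiffAt_boundaryless (t₀ := 0) hv
  refine ⟨e, h0, he.mono fun t ht => ⟨ht.mdifferentiableAt, ?_⟩⟩
  have h1 := congrArg (fun L : ℝ →L[ℝ] G.Coord => L 1) ht.mfderiv
  have h2 : (mfderiv 𝓘(ℝ, ℝ) G.model e t : ℝ →L[ℝ] G.Coord) 1 = mulInvariantVectorField X (e t) :=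
    h1.trans (one_smul ℝ (mulInvariantVectorField X (e t) : G.Coord))
  refine Eq.trans ?_ (mfderiv_inv_mul_mulInvariantVectorField X (e t))
  exact congrArg (mfderiv G.model G.model (fun x : G => (e t)⁻¹ * x) (e t) :
    G.Coord →L[ℝ] G.Coord) h2

namespace IsLocalExp

variable {e : ℝ → G} {X : G.LieAlg}

theorem hasMFDerivAt (h : IsLocalExp e X) : HasMFDerivAt 𝓘(ℝ, ℝ) G.model e 0
    (ContinuousLinearMap.toSpanSingleton ℝ (X : G.Coord)) := by
  obtain ⟨h1, h2⟩ := h.eventually.self_of_nhds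
  have e1 : (fun s => (e 0)⁻¹ * e s) = e := by ext s; simp [h.map_zero]
  have h4 := (leftDeriv_eq_mfderiv e 0).symm.trans h2
  have h5 : ∀ f : ℝ → G, f = e →
      (mfderiv 𝓘(ℝ, ℝ) G.model f 0 : ℝ →L[ℝ] G.Coord) 1 = X →
      HasMFDerivAt 𝓘(ℝ, ℝ) G.model e 0 (ContinuousLinearMap.toSpanSingleton ℝ (X : G.Coord)) := by
    rintro f rfl hf
    have h6 : ContinuousLinearMap.toSpanSingleton ℝ (X : G.Coord) =
        (mfderiv 𝓘(ℝ, ℝ) G.model f 0 : ℝ →L[ℝ] G.Coord) := by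
      refine ContinuousLinearMap.ext_ring ?_
      exact (one_smul ℝ (X : G.Coord)).trans hf.symm
    exact h6 ▸ h1.hasMFDerivAt
  exact h5 _ e1 h4

theorem continuousAt (h : IsLocalExp e X) : ContinuousAt e 0 :=
  h.hasMFDerivAt.continuousAt

theorem hasDerivAt_chart (h : IsLocalExp e X) :
    HasDerivAt (fun t => chartOne G.Coord G (e t)) (X : G.Coord) 0 := by
  have h1 := HasMFDerivAt.comp (0 : ℝ) (hasMFDerivAt_congr_point
    (hasMFDerivAt_chartOne (E := G.Coord) (G := G)) h.map_zero.symm) h.hasMFDerivAt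
  have h2 := hasMFDerivAt_iff_hasFDerivAt.1 h1
  have h3 := HasFDerivAt.hasDerivAt (𝕜 := ℝ) (F := G.Coord)
    (f' := (ContinuousLinearMap.id ℝ G.Coord).comp
      (ContinuousLinearMap.toSpanSingleton ℝ (X : G.Coord))) h2
  exact HasDerivAt.congr_deriv (F := G.Coord) h3 (one_smul ℝ (X : G.Coord))

/-- Strictness is what the open mapping argument in Chow's theorem needs. Each cut-off coordinate
has derivative `leftDiff` at `e t` applied to the fixed vector `X`, which is continuous in `t`. -/
theorem hasStrictDerivAt_chart (h : IsLocalExp e X) :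
    HasStrictDerivAt (fun t => chartOne G.Coord G (e t)) (X : G.Coord) 0 := by
  obtain ⟨f, -⟩ := (SmoothBumpFunction.nhds_basis_support (I := G.model) (c := (1 : G))
    univ_mem).ex_mem
  obtain ⟨x, hx⟩ : ∃ x : G.Coord, x = X := ⟨_, rfl⟩
  suffices HasStrictDerivAt (fun t => chartOne G.Coord G (e t)) x 0 by
    rw [hx] at this; exact this
  rw [hasStrictDerivAt_iff_hasStrictFDerivAt, hasStrictFDerivAt_euclidean]
  intro i
  let φ : G → ℝ := fun x => f x • (chartOne G.Coord G x) i
  have hφ : ContMDiff G.model 𝓘(ℝ, ℝ) ∞ φ := by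
    refine f.contMDiff_smul ?_
    have h1 := contMDiffOn_extChartAt (I := G.model) (n := ∞) (x := (1 : G))
    have h2 : ContMDiff 𝓘(ℝ, G.Coord) 𝓘(ℝ, ℝ) ∞ (fun y : G.Coord => y i) :=
      (EuclideanSpace.proj (𝕜 := ℝ) i).contDiff.contMDiff
    exact h2.comp_contMDiffOn h1
  have hd : ∀ᶠ t in 𝓝 (0 : ℝ), HasDerivAt (fun s => φ (e s))
      (leftDiff G.Coord φ (e t) (X : G.Coord)) t := by
    filter_upwards [h.eventually] with t ht
    have := hasDerivAt_comp_curve hφ ht.1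
    rwa [ht.2] at this
  have hs : HasStrictDerivAt (fun s => φ (e s)) (leftDiff G.Coord φ (e 0) (X : G.Coord)) 0 := by
    refine hasStrictDerivAt_of_hasDerivAt_of_continuousAt hd ?_
    exact ContinuousAt.comp
      (contMDiff_leftDiff (E := G.Coord) hφ (X : G.Coord)).continuous.continuousAt h.continuousAt
  have heq : (fun s => φ (e s)) =ᶠ[𝓝 0] fun s => chartOne G.Coord G (e s) i := by
    have h1 : ∀ᶠ g in 𝓝 (e 0), f g = 1 := by rw [h.map_zero]; exact f.eventuallyEq_one
    filter_upwards [h.continuousAt.eventually h1] with s hs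
    simp [φ, hs]
  have hs' := hs.congr_of_eventuallyEq heq
  have hd' : HasDerivAt (fun s => chartOne G.Coord G (e s) i) (x i) 0 := by
    have h1 := h.hasDerivAt_chart
    rw [← hx] at h1
    exact (EuclideanSpace.proj (𝕜 := ℝ) i).hasFDerivAt.comp_hasDerivAt 0 h1
  rw [hs'.hasDerivAt.unique hd'] at hs'
  refine hs'.hasStrictFDerivAt.congr_fderiv ?_
  ext
  simp

/-- The curve between parameters `0` and `t`, rescaled to `[0,1]`, has constant left-trivialized
velocity `t • X`, which is horizontal; its length is the bound. -/
theorem eventually_ccDist_le (h : IsLocalExp e X) (hX : X ∈ G.layer 1) :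
    ∀ᶠ t in 𝓝 (0 : ℝ), G.ccDist 1 (e t) ≤ ENNReal.ofReal (|t| * G.algNorm X) := by
  obtain ⟨δ, hδ, hb⟩ := Metric.eventually_nhds_iff_ball.1 h.eventually
  filter_upwards [Metric.ball_mem_nhds (0 : ℝ) hδ] with t ht
  rcases eq_or_ne t 0 with rfl | ht0
  · rw [h.map_zero, ccDist_self]; exact zero_le
  have hmem : ∀ τ ∈ Icc (0 : ℝ) 1, 0 + t * τ ∈ Metric.ball (0 : ℝ) δ := by
    intro τ hτ
    rw [Metric.mem_ball, dist_zero_right, Real.norm_eq_abs] at ht ⊢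
    rw [zero_add, abs_mul, abs_of_nonneg hτ.1]
    have := mul_le_of_le_one_right (abs_nonneg t) hτ.2
    linarith
  let γ : ℝ → G := fun τ => e (0 + t * τ)
  have hld : ∀ τ ∈ Icc (0 : ℝ) 1, G.leftDeriv γ τ = t • X := fun τ hτ => by
    rw [leftDeriv_comp_affine e 0 ht0, (hb _ (hmem τ hτ)).2]
  have hmd : ∀ τ ∈ Icc (0 : ℝ) 1, MDifferentiableAt 𝓘(ℝ, ℝ) G.model γ τ := fun τ hτ =>
    MDifferentiableAt.comp τ (hb _ (hmem τ hτ)).1 (hasMFDerivAt_affine 0 t τ).mdifferentiableAt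
  have hγ : G.IsHorizontal γ := by
    refine ⟨fun φ hφ => ?_, ?_⟩
    · have hcont : ContinuousOn (fun τ => leftDiff G.Coord φ (γ τ) ((t • X : G.LieAlg) : G.Coord))
          (uIcc 0 1) := by
        intro τ hτ
        rw [uIcc_of_le zero_le_one] at hτ
        exact (ContinuousAt.comp
          (contMDiff_leftDiff (E := G.Coord) hφ ((t • X : G.LieAlg) : G.Coord)).continuous.continuousAt
          (hmd τ hτ).continuousAt).continuousWithinAt
      refine .of_eq_integral hcont.intervalIntegrable fun x hx => ?_
      have := intervalIntegral.integral_eq_sub_of_hasDerivAt (a := 0) (b := x)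
        (f := fun τ => φ (γ τ)) (f' := fun τ => leftDiff G.Coord φ (γ τ) ((t • X : G.LieAlg) : G.Coord))
        (fun τ hτ => ?_) (hcont.mono (uIcc_subset_uIcc_left hx)).intervalIntegrable
      · rw [this]; ring
      · have hτ' := uIcc_subset_uIcc_left hx hτ
        rw [uIcc_of_le zero_le_one] at hτ'
        have := hasDerivAt_comp_curve hφ (hmd τ hτ')
        rwa [hld τ hτ'] at this
    · rw [ae_restrict_iff' measurableSet_Icc]
      exact ae_of_all _ fun τ hτ => by rw [hld τ hτ]; exact Submodule.smul_mem _ _ hX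
  have hlen : G.length γ = ENNReal.ofReal (|t| * G.algNorm X) := by
    rw [length, setLIntegral_congr_fun measurableSet_Icc
      (g := fun _ => ENNReal.ofReal (|t| * G.algNorm X))
      (fun τ hτ => by simp only [hld τ hτ, algNorm_smul])]
    simp
  have := ccDist_le_length hγ
  have h0 : γ 0 = 1 := by simp [γ, h.map_zero]
  have h1 : γ 1 = e t := by simp [γ]
  rwa [h0, h1, hlen] at this

theorem tendsto_ccDist (h : IsLocalExp e X) (hX : X ∈ G.layer 1) :
    Tendsto (fun t => G.ccDist 1 (e t)) (𝓝 0) (𝓝 0) := by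
  refine tendsto_of_tendsto_of_tendsto_of_le_of_le' tendsto_const_nhds ?_
    (Eventually.of_forall fun _ => zero_le) (h.eventually_ccDist_le hX)
  have : Continuous fun t : ℝ => ENNReal.ofReal (|t| * G.algNorm X) :=
    ENNReal.continuous_ofReal.comp (by fun_prop)
  exact this.tendsto' 0 0 (by simp)

theorem hasDerivAt_adj (h : IsLocalExp e X) (Z : G.LieAlg) :
    HasDerivAt (fun t => adj G.Coord (e t) Z) ((⁅X, Z⁆ : G.LieAlg) : G.Coord) 0 := by
  obtain ⟨A, hA, hAX⟩ := hasMFDerivAt_adj_one (E := G.Coord) (G := G) Z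
  have h1 := HasMFDerivAt.comp (0 : ℝ) (hasMFDerivAt_congr_point hA h.map_zero.symm) h.hasMFDerivAt
  have h3 := HasFDerivAt.hasDerivAt (𝕜 := ℝ) (F := G.Coord)
    (f' := A.comp (ContinuousLinearMap.toSpanSingleton ℝ (X : G.Coord)))
    (hasMFDerivAt_iff_hasFDerivAt.1 h1)
  refine HasDerivAt.congr_deriv (F := G.Coord) h3 (Eq.trans ?_ (hAX X))
  exact congrArg A (one_smul ℝ (X : G.Coord))

theorem hasStrictDerivAt_chart_conj (h : IsLocalExp e X) (a : G) :
    HasStrictDerivAt (fun t => chartOne G.Coord G (a * e t * a⁻¹)) (adj G.Coord a X) 0 := by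
  have h1 : ContDiffAt ℝ ∞ (fun y => chartOne G.Coord G (a * (chartOne G.Coord G).symm y * a⁻¹))
      (coordOne G.Coord G) := by
    rw [← contMDiffAt_iff_contDiffAt]
    have hs := contMDiffAt_chartOne_symm (E := G.Coord) (G := G)
    have he : a * (chartOne G.Coord G).symm (coordOne G.Coord G) * a⁻¹ = 1 := by simp
    have hc : ContMDiffAt 𝓘(ℝ, G.Coord) 𝓘(ℝ, G.Coord) ∞ (chartOne G.Coord G)
        (a * (chartOne G.Coord G).symm (coordOne G.Coord G) * a⁻¹) := by
      rw [he]; exact contMDiffAt_chartOne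
    exact ContMDiffAt.comp (coordOne G.Coord G) hc ((contMDiff_conj a).contMDiffAt.comp _ hs)
  have h2 := HasMFDerivAt.comp (1 : G) (hasMFDerivAt_congr_point
    (hasMFDerivAt_chartOne (E := G.Coord) (G := G))
    (show 1 = a * 1 * a⁻¹ by simp)) (hasMFDerivAt_conj (E := G.Coord) a)
  have h3 : HasFDerivAt (fun y => chartOne G.Coord G (a * (chartOne G.Coord G).symm y * a⁻¹))
      (adj G.Coord a) (coordOne G.Coord G) := (hasMFDerivAt_one_iff.1 h2).2
  have h4 := h1.hasStrictFDerivAt (by simp)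
  rw [h3.fderiv] at h4
  rw [← chartOne_one, ← h.map_zero] at h4
  have h5 := HasStrictFDerivAt.comp_hasStrictDerivAt (0 : ℝ)
    (f := fun t => chartOne G.Coord G (e t)) h4 h.hasStrictDerivAt_chart
  refine h5.congr_of_eventuallyEq ?_
  have : ∀ᶠ t in 𝓝 (0 : ℝ), e t ∈ (chartOne G.Coord G).source :=
    h.continuousAt (by rw [h.map_zero]; exact chartOne_source_mem_nhds)
  filter_upwards [this] with t ht
  simp [(chartOne G.Coord G).left_inv ht]

end IsLocalExp

end CarnotGroup

/-! ### Products of curves in the chart, and Chow's theorem. -/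

section LieGroupChart

variable {E : Type*} [NormedAddCommGroup E] [NormedSpace ℝ E]
  {G : Type*} [TopologicalSpace G] [ChartedSpace E G] [Group G] [LieGroup 𝓘(ℝ, E) ∞ G]

theorem hasStrictFDerivAt_chartOne_mul : HasStrictFDerivAt
    (fun p : E × E => chartOne E G ((chartOne E G).symm p.1 * (chartOne E G).symm p.2))
    (ContinuousLinearMap.fst ℝ E E + ContinuousLinearMap.snd ℝ E E)
    (coordOne E G, coordOne E G) := by
  have hM := (contDiffAt_inChart (E := E) (G := G) (Φ := fun p => p.1 * p.2)
    (contMDiff_mul 𝓘(ℝ, E) ∞) (by simp)).hasStrictFDerivAt (by simp)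
  refine hM.congr_fderiv ?_
  have h1 := HasFDerivAt.comp (coordOne E G) (f := fun x : E => (x, coordOne E G)) hM.hasFDerivAt
    (hasFDerivAt_prodMk_left (𝕜 := ℝ) _ (coordOne E G))
  have h2 := HasFDerivAt.comp (coordOne E G) (f := fun x : E => (coordOne E G, x)) hM.hasFDerivAt
    (hasFDerivAt_prodMk_right (𝕜 := ℝ) (coordOne E G) _)
  have e1 : (fun x : E => chartOne E G ((chartOne E G).symm x *
      (chartOne E G).symm (coordOne E G))) =ᶠ[𝓝 (coordOne E G)] id := by
    filter_upwards [chartOne_target_mem_nhds (E := E) (G := G)] with x hx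
    simp [(chartOne E G).right_inv hx]
  have e2 : (fun x : E => chartOne E G ((chartOne E G).symm (coordOne E G) *
      (chartOne E G).symm x)) =ᶠ[𝓝 (coordOne E G)] id := by
    filter_upwards [chartOne_target_mem_nhds (E := E) (G := G)] with x hx
    simp [(chartOne E G).right_inv hx]
  have h1' := h1.unique ((hasFDerivAt_id _).congr_of_eventuallyEq e1)
  have h2' := h2.unique ((hasFDerivAt_id _).congr_of_eventuallyEq e2)
  refine ContinuousLinearMap.prod_ext ?_ ?_
  · rw [h1']; ext; simp
  · rw [h2']; ext; simp

theorem HasStrictFDerivAt.chartOne_mul {T : Type*} [NormedAddCommGroup T] [NormedSpace ℝ T]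
    {f g : T → G} {t : T} {A B : T →L[ℝ] E} (hf1 : f t = 1) (hg1 : g t = 1)
    (hfc : ContinuousAt f t) (hgc : ContinuousAt g t)
    (hf : HasStrictFDerivAt (fun s => chartOne E G (f s)) A t)
    (hg : HasStrictFDerivAt (fun s => chartOne E G (g s)) B t) :
    HasStrictFDerivAt (fun s => chartOne E G (f s * g s)) (A + B) t := by
  have hM := hasStrictFDerivAt_chartOne_mul (E := E) (G := G)
  have e : (coordOne E G, coordOne E G) = (chartOne E G (f t), chartOne E G (g t)) := by
    rw [hf1, hg1]; rfl
  rw [e] at hM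
  have h1 := HasStrictFDerivAt.comp t
    (f := fun s => (chartOne E G (f s), chartOne E G (g s))) hM (hf.prodMk hg)
  refine (h1.congr_of_eventuallyEq ?_).congr_fderiv (by ext; simp)
  have hf' : ∀ᶠ s in 𝓝 t, f s ∈ (chartOne E G).source :=
    hfc (by rw [hf1]; exact chartOne_source_mem_nhds)
  have hg' : ∀ᶠ s in 𝓝 t, g s ∈ (chartOne E G).source :=
    hgc (by rw [hg1]; exact chartOne_source_mem_nhds)
  filter_upwards [hf', hg'] with s h1 h2
  simp [(chartOne E G).left_inv h1, (chartOne E G).left_inv h2]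

/-- The derivative of multiplication at `(1, 1)` is addition. Value and continuity are carried
through the induction because the product rule holds only for factors near `1`. -/
theorem hasStrictFDerivAt_chartOne_list_prod {n : ℕ} {c : Fin n → ℝ → G} {Z : Fin n → E}
    (h0 : ∀ i, c i 0 = 1) (hc : ∀ i, ContinuousAt (c i) 0)
    (hd : ∀ i, HasStrictDerivAt (fun t => chartOne E G (c i t)) (Z i) 0) (l : List (Fin n)) :
    (l.map fun i => c i ((0 : Fin n → ℝ) i)).prod = 1 ∧
    ContinuousAt (fun t : Fin n → ℝ => (l.map fun i => c i (t i)).prod) 0 ∧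
    HasStrictFDerivAt (fun t : Fin n → ℝ => chartOne E G (l.map fun i => c i (t i)).prod)
      (l.map fun i => (ContinuousLinearMap.proj (R := ℝ) (φ := fun _ : Fin n => ℝ) i).smulRight
        (Z i)).sum 0 := by
  have : IsTopologicalGroup G := topologicalGroup_of_lieGroup 𝓘(ℝ, E) ∞
  induction l with
  | nil => exact ⟨rfl, continuousAt_const, by simpa using hasStrictFDerivAt_const _ _⟩
  | cons i l ih =>
    obtain ⟨ih1, ih2, ih3⟩ := ih
    have hci : ContinuousAt (fun t : Fin n → ℝ => c i (t i)) 0 :=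
      ContinuousAt.comp (f := fun t : Fin n → ℝ => t i) (x := 0) (by exact hc i)
        (continuous_apply i).continuousAt
    simp only [List.map_cons, List.prod_cons, List.sum_cons]
    refine ⟨?_, hci.mul ih2, ?_⟩
    · rw [ih1]; simp [h0]
    · refine HasStrictFDerivAt.chartOne_mul (by simp [h0]) ih1 hci ih2 ?_ ih3
      have h1 := HasStrictFDerivAt.comp (0 : Fin n → ℝ) (f := fun t : Fin n → ℝ => t i)
        (g := fun t => chartOne E G (c i t)) (hd i).hasStrictFDerivAt
        (ContinuousLinearMap.proj (R := ℝ) (φ := fun _ : Fin n => ℝ) i).hasStrictFDerivAt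
      refine h1.congr_fderiv ?_
      ext; simp

end LieGroupChart

namespace CarnotGroup

variable {G : CarnotGroup.{u}}

theorem ccDist_one_mul_le (x y : G) : G.ccDist 1 (x * y) ≤ G.ccDist 1 x + G.ccDist 1 y := by
  refine (ccDist_triangle 1 x (x * y)).trans_eq ?_
  rw [← ccDist_mul_left x 1 y, mul_one]

theorem ccDist_one_inv (x : G) : G.ccDist 1 x⁻¹ = G.ccDist 1 x := by
  rw [← ccDist_mul_left x 1 x⁻¹, mul_one, mul_inv_cancel, ccDist_comm]

theorem ccDist_one_conj_le (a x : G) :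
    G.ccDist 1 (a * x * a⁻¹) ≤ 2 * G.ccDist 1 a + G.ccDist 1 x := by
  refine (ccDist_one_mul_le _ _).trans ?_
  rw [ccDist_one_inv]
  calc _ ≤ G.ccDist 1 a + G.ccDist 1 x + G.ccDist 1 a := by gcongr; exact ccDist_one_mul_le _ _
    _ = _ := by ring

theorem ccDist_one_list_prod_le {ι : Type*} (l : List ι) (c : ι → G) {δ : ℝ≥0∞}
    (h : ∀ i, G.ccDist 1 (c i) ≤ δ) : G.ccDist 1 (l.map c).prod ≤ l.length * δ := by
  induction l with
  | nil => simp [ccDist_self]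
  | cons i l ih =>
    simp only [List.map_cons, List.prod_cons, List.length_cons, Nat.cast_add, Nat.cast_one, add_mul,
      one_mul]
    refine (ccDist_one_mul_le _ _).trans ?_
    rw [add_comm]
    gcongr
    exact h i

variable (G) in
/-- The span of the images of the first layer under the adjoint action of the elements at distance
less than `ε` from the identity. -/
def adjSpan (ε : ℝ≥0∞) : Submodule ℝ G.Coord :=
  Submodule.span ℝ {Z | ∃ a : G, ∃ X ∈ G.layer 1, G.ccDist 1 a < ε ∧ adj G.Coord a X = Z}

theorem adj_mem_adjSpan {g : G} {ε ε' : ℝ≥0∞} (hg : G.ccDist 1 g < ε) {Z : G.Coord}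
    (hZ : Z ∈ adjSpan G ε') : adj G.Coord g Z ∈ adjSpan G (ε + ε') := by
  have : adjSpan G ε' ≤ (adjSpan G (ε + ε')).comap (adj G.Coord g).toLinearMap := by
    refine Submodule.span_le.2 ?_
    rintro _ ⟨a, X, hX, ha, rfl⟩
    refine Submodule.subset_span ⟨g * a, X, hX, ?_, ?_⟩
    · exact (ccDist_one_mul_le g a).trans_lt (ENNReal.add_lt_add hg ha)
    · rw [adj_mul]; rfl
  exact this hZ

/-- A generator `⁅X, Y⁆` of the next layer is the derivative at `0` of `Ad (e t) Y`, where `e` is a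
short curve in the horizontal direction `X`. By induction these vectors stay in the span, which is
closed, so the derivative does too. -/
theorem layer_subset_adjSpan (k : ℕ) : ∀ ε : ℝ≥0∞, 0 < ε → ∀ X ∈ G.layer k,
    (X : G.Coord) ∈ adjSpan G ε := by
  induction k with
  | zero =>
    intro ε _ X hX
    rw [G.layer_zero, Submodule.mem_bot] at hX
    rw [hX]
    exact (adjSpan G ε).zero_mem
  | succ k ih =>
    intro ε hε X hX
    rcases Nat.eq_zero_or_pos k with rfl | hk
    · refine Submodule.subset_span ⟨1, X, hX, by rwa [ccDist_self], ?_⟩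
      rw [adj_one]; rfl
    · rw [← G.span_bracket k hk] at hX
      refine Submodule.span_induction (p := fun X _ => (X : G.Coord) ∈ adjSpan G ε) ?_ ?_ ?_ ?_ hX
      · rintro _ ⟨X, hX, Y, hY, rfl⟩
        obtain ⟨e, he⟩ := exists_isLocalExp X
        have hε2 : 0 < ε / 2 := ENNReal.half_pos hε.ne'
        have hY' := ih _ hε2 Y hY
        have h1 : ∀ᶠ t in 𝓝 (0 : ℝ), adj G.Coord (e t) Y ∈ adjSpan G ε := by
          filter_upwards [(he.tendsto_ccDist hX).eventually_lt_const hε2] with t ht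
          have := adj_mem_adjSpan ht hY'
          rwa [ENNReal.add_halves] at this
        have h2 := hasDerivAt_iff_tendsto_slope.1 (he.hasDerivAt_adj Y)
        refine (Submodule.closed_of_finiteDimensional (adjSpan G ε)).mem_of_tendsto h2 ?_
        filter_upwards [nhdsWithin_le_nhds h1] with t ht
        exact (adjSpan G ε).smul_mem _ ((adjSpan G ε).sub_mem ht h1.self_of_nhds)
      · exact (adjSpan G ε).zero_mem
      · exact fun X Y _ _ hX hY => (adjSpan G ε).add_mem hX hY
      · exact fun c X _ hX => (adjSpan G ε).smul_mem c hX

theorem adjSpan_eq_top {ε : ℝ≥0∞} (hε : 0 < ε) : adjSpan G ε = ⊤ := by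
  refine eq_top_iff.2 fun X _ => ?_
  have hX : (X : G.LieAlg) ∈ ⨆ k, G.layer k := by
    rw [G.layer_isInternal.submodule_iSup_eq_top]; trivial
  refine Submodule.iSup_induction G.layer (motive := fun X => (X : G.Coord) ∈ adjSpan G ε) hX
    (fun k X hX => layer_subset_adjSpan k ε hε X hX) (adjSpan G ε).zero_mem
    fun X Y hX hY => (adjSpan G ε).add_mem hX hY

/-- **Chow's theorem**: the sub-Riemannian balls are neighbourhoods of their centres. -/
theorem setOf_ccDist_one_lt_mem_nhds {ε : ℝ≥0∞} (hε : 0 < ε) : {g : G | G.ccDist 1 g < ε} ∈ 𝓝 1 := by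
  -- There will be `dim` factors `a x a⁻¹`, each at distance at most `2 δ + δ` from `1`.
  obtain ⟨δ, hδ, hδε⟩ := ENNReal.exists_nnreal_pos_mul_lt (a := 3 * G.dim)
    (ENNReal.mul_ne_top (by simp) (by simp)) hε.ne'
  have htop : adjSpan G δ = ⊤ := adjSpan_eq_top (by exact_mod_cast hδ)
  obtain ⟨Z, hZ, hspan, -⟩ := Submodule.exists_fun_fin_finrank_span_eq ℝ
    {Z : G.Coord | ∃ a : G, ∃ X ∈ G.layer 1, G.ccDist 1 a < δ ∧ adj G.Coord a X = Z}
  change Submodule.span ℝ (range Z) = adjSpan G δ at hspan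
  rw [htop] at hspan
  have hn : Module.finrank ℝ (Submodule.span ℝ {Z : G.Coord | ∃ a : G, ∃ X ∈ G.layer 1,
      G.ccDist 1 a < δ ∧ adj G.Coord a X = Z}) = G.dim := by
    change Module.finrank ℝ (adjSpan G δ) = G.dim
    rw [htop, finrank_top, finrank_euclideanSpace_fin]
  revert Z
  rw [hn]
  intro Z hZ hspan
  choose a X hX ha hZ using hZ
  choose e he using fun i => exists_isLocalExp (X i)
  -- The velocity of `c i` at `0` is `Ad (a i) (X i) = Z i`. As the `Z i` span, the product map of
  -- all the `c i` has surjective strict derivative at `0` and maps neighbourhoods onto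
  -- neighbourhoods.
  let c : Fin G.dim → ℝ → G := fun i t => a i * e i t * (a i)⁻¹
  obtain ⟨hp0, hpc, hpd⟩ := hasStrictFDerivAt_chartOne_list_prod (E := G.Coord) (c := c) (Z := Z)
    (fun i => by simp [c, (he i).map_zero])
    (fun i => (continuousAt_const.mul (he i).continuousAt).mul continuousAt_const)
    (fun i => hZ i ▸ (he i).hasStrictDerivAt_chart_conj (a i)) (List.finRange G.dim)
  have hsurj := hpd.map_nhds_eq_of_surj (by
    rw [← List.ofFn_eq_map, List.sum_ofFn, LinearMap.range_eq_top]
    intro z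
    obtain ⟨t, ht⟩ := (Submodule.mem_span_range_iff_exists_fun ℝ).1
      (hspan.symm ▸ Submodule.mem_top : z ∈ Submodule.span ℝ (range Z))
    exact ⟨t, by simpa using ht⟩)
  have hdist : ∀ᶠ t in 𝓝 (0 : Fin G.dim → ℝ),
      G.ccDist 1 ((List.finRange G.dim).map fun i => c i (t i)).prod < ε := by
    have : ∀ i, ∀ᶠ t in 𝓝 (0 : Fin G.dim → ℝ), G.ccDist 1 (e i (t i)) < δ := fun i =>
      (((he i).tendsto_ccDist (hX i)).comp
        (tendsto_pi_nhds.1 (tendsto_id (x := 𝓝 (0 : Fin G.dim → ℝ))) i)).eventually_lt_const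
        (by exact_mod_cast hδ)
    filter_upwards [eventually_all.2 this] with t ht
    refine (ccDist_one_list_prod_le _ (fun i => c i (t i)) (δ := 3 * δ) fun i => ?_).trans_lt ?_
    · refine (ccDist_one_conj_le _ _).trans ?_
      calc _ ≤ 2 * (δ : ℝ≥0∞) + δ := by gcongr; exacts [(ha i).le, (ht i).le]
        _ = _ := by ring
    · rw [List.length_finRange]
      refine lt_of_eq_of_lt ?_ hδε
      ring
  have h1 : ∀ᶠ y in 𝓝 (coordOne G.Coord G), ∃ t : Fin G.dim → ℝ,
      G.ccDist 1 ((List.finRange G.dim).map fun i => c i (t i)).prod < ε ∧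
      ((List.finRange G.dim).map fun i => c i (t i)).prod ∈ (chartOne G.Coord G).source ∧
      chartOne G.Coord G ((List.finRange G.dim).map fun i => c i (t i)).prod = y := by
    rw [hp0, chartOne_one] at hsurj
    rw [← hsurj]
    have hs' := chartOne_source_mem_nhds (E := G.Coord) (G := G)
    rw [← hp0] at hs'
    have hs := hpc hs'
    exact Filter.eventually_map.2 (by filter_upwards [hdist, hs] with t h1 h2 using ⟨t, h1, h2, rfl⟩)
  filter_upwards [tendsto_chartOne (E := G.Coord) (G := G) h1, 
    chartOne_source_mem_nhds (E := G.Coord)] with g hg hgs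
  obtain ⟨t, ht, hts, hte⟩ := hg
  rw [← (chartOne G.Coord G).injOn hts hgs hte]
  exact ht

end CarnotGroup

/-! ### Connected preimages, fixed vectors of the adjoint action and open homomorphisms. -/

/-- The images of two open pieces are open and cover `s`, so they share a point of `s`; the fibre
over that point meets both pieces, and its connectedness makes them intersect. -/
theorem IsPreconnected.preimage_of_isOpenMap_of_fibers {α β : Type*} [TopologicalSpace α]
    [TopologicalSpace β] {f : α → β} {s : Set β} (hs : IsPreconnected s) (hf : IsOpenMap f)
    (hsf : s ⊆ range f) (hfib : ∀ y ∈ s, IsPreconnected (f ⁻¹' {y})) :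
    IsPreconnected (f ⁻¹' s) := fun u v hu hv hsuv hsu hsv => by
  replace hsf : f '' f ⁻¹' s = s := image_preimage_eq_of_subset hsf
  obtain ⟨y, hy, ⟨a, hau, rfl⟩, ⟨b, hbv, hb⟩⟩ : (s ∩ (f '' u ∩ f '' v)).Nonempty := by
    refine hs (f '' u) (f '' v) (hf u hu) (hf v hv) ?_ ?_ ?_
    · simpa only [hsf, image_union] using image_mono (f := f) hsuv
    · simpa only [image_preimage_inter] using hsu.image f
    · simpa only [image_preimage_inter] using hsv.image f
  have hsub : f ⁻¹' {f a} ⊆ f ⁻¹' s := preimage_mono (singleton_subset_iff.2 hy)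
  obtain ⟨c, hc, hcuv⟩ := hfib _ hy u v hu hv (hsub.trans hsuv) ⟨a, rfl, hau⟩ ⟨b, hb, hbv⟩
  exact ⟨c, hsub hc, hcuv⟩

section LieGroupChart

variable {E : Type*} [NormedAddCommGroup E] [NormedSpace ℝ E] [CompleteSpace E]
  {G : Type*} [TopologicalSpace G] [ChartedSpace E G] [Group G] [LieGroup 𝓘(ℝ, E) ∞ G]

/-- A central element of the Lie algebra of a connected Lie group is fixed by the adjoint action. -/
theorem adj_apply_eq_of_lie_eq_zero [ConnectedSpace G] (Z : GroupLieAlgebra 𝓘(ℝ, E) G)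
    (hZ : ∀ Y : GroupLieAlgebra 𝓘(ℝ, E) G, ⁅Y, Z⁆ = 0) (g : G) : adj E g Z = Z := by
  have : IsTopologicalGroup G := topologicalGroup_of_lieGroup 𝓘(ℝ, E) ∞
  have : IsManifold 𝓘(ℝ, E) 1 G := IsManifold.of_le (n := ∞) (by norm_num)
  obtain ⟨A, hA, hAY⟩ := hasMFDerivAt_adj_one (E := E) (G := G) Z
  obtain rfl : A = 0 := by
    ext Y
    exact (hAY Y).trans (hZ Y)
  -- Since `Ad g = Ad h ∘ Ad (h⁻¹ g)`, the vanishing of the derivative at `1` spreads to every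
  -- point.
  have hd : ∀ h : G, HasMFDerivAt 𝓘(ℝ, E) 𝓘(ℝ, E) (fun g : G => adj E g Z) h (0 : E →L[ℝ] E) := by
    intro h
    obtain ⟨M, hl⟩ : ∃ M : E →L[ℝ] E,
        HasMFDerivAt 𝓘(ℝ, E) 𝓘(ℝ, E) (fun y : G => h⁻¹ * y) h M :=
      ⟨_, ((contMDiff_mul_left (n := ∞)).mdifferentiable (by simp) h).hasMFDerivAt⟩
    have h1 := HasMFDerivAt.comp h (hasMFDerivAt_congr_point hA (inv_mul_cancel h).symm) hl
    have h2 := HasMFDerivAt.comp h (g := adj E h) (adj E h).hasMFDerivAt h1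
    have e : (adj E h) ∘ (fun g : G => adj E g Z) ∘ (fun y : G => h⁻¹ * y) =
        fun g : G => adj E g Z := by
      ext g
      have := adj_mul (E := E) h (h⁻¹ * g)
      rw [mul_inv_cancel_left] at this
      rw [this]; rfl
    rw [e] at h2
    have e0 : (adj E h).comp ((0 : E →L[ℝ] E).comp M) = 0 := by
      rw [ContinuousLinearMap.zero_comp, ContinuousLinearMap.comp_zero]
    exact e0 ▸ h2
  have hloc : ∀ᶠ y in 𝓝 (coordOne E G), adj E ((chartOne E G).symm y) Z = Z := by
    obtain ⟨r, hr, hsub⟩ := Metric.mem_nhds_iff.1 (chartOne_target_mem_nhds (E := E) (G := G))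
    have hf : ∀ y ∈ Metric.ball (coordOne E G) r,
        HasFDerivAt (fun y => adj E ((chartOne E G).symm y) Z) (0 : E →L[ℝ] E) y := by
      intro y hy
      have ho : IsOpen (chartOne E G).target := isOpen_extChartAt_target (I := 𝓘(ℝ, E)) (1 : G)
      have hs : HasMFDerivAt 𝓘(ℝ, E) 𝓘(ℝ, E) (chartOne E G).symm y
          (mfderiv 𝓘(ℝ, E) 𝓘(ℝ, E) (chartOne E G).symm y) :=
        (((contMDiffOn_extChartAt_symm (n := ∞) (1 : G)).contMDiffAt
          (ho.mem_nhds (hsub hy))).mdifferentiableAt (by simp)).hasMFDerivAt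
      have h1 := HasMFDerivAt.comp y (hd ((chartOne E G).symm y)) hs
      have h2 := hasMFDerivAt_iff_hasFDerivAt.1 h1
      have h3 : HasFDerivAt (fun y => adj E ((chartOne E G).symm y) Z)
        ((0 : E →L[ℝ] E).comp (mfderiv 𝓘(ℝ, E) 𝓘(ℝ, E) (chartOne E G).symm y : E →L[ℝ] E)) y := h2
      exact h3.congr_fderiv (ContinuousLinearMap.zero_comp _)
    filter_upwards [Metric.ball_mem_nhds _ hr] with y hy
    have h1 := Metric.isOpen_ball.is_const_of_fderiv_eq_zero (𝕜 := ℝ)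
      (convex_ball (coordOne E G) r).isPreconnected
      (fun y hy => (hf y hy).differentiableAt.differentiableWithinAt)
      (fun y hy => (hf y hy).fderiv) hy (Metric.mem_ball_self hr)
    refine h1.trans ?_
    show adj E ((chartOne E G).symm (coordOne E G)) Z = Z
    rw [chartOne_symm_coordOne, adj_one]; rfl
  -- The stabilizer of `Z` contains a neighbourhood of `1`; an open subgroup is closed, so by
  -- connectedness it is everything.
  let S : Subgroup G :=
    { carrier := {g | adj E g Z = Z}
      one_mem' := by
        show adj E 1 Z = Z
        rw [adj_one]; rfl
      mul_mem' := fun {a b} (ha : adj E a Z = Z) (hb : adj E b Z = Z) => by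
        show adj E (a * b) Z = Z
        rw [adj_mul]
        exact (congrArg (adj E a) hb).trans ha
      inv_mem' := fun {a} (ha : adj E a Z = Z) => by
        show adj E a⁻¹ Z = Z
        have h1 := adj_mul (E := E) a⁻¹ a
        rw [inv_mul_cancel, adj_one] at h1
        have h2 := congrArg (fun L : E →L[ℝ] E => L Z) h1
        refine Eq.trans (congrArg (adj E a⁻¹) ha).symm h2.symm }
  have hS : (S : Set G) ∈ 𝓝 1 := by
    filter_upwards [tendsto_chartOne (E := E) (G := G) hloc, chartOne_source_mem_nhds (E := E)]
      with g hg hgs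
    have : adj E ((chartOne E G).symm (chartOne E G g)) Z = Z := hg
    rwa [(chartOne E G).left_inv hgs] at this
  have ho := S.isOpen_of_mem_nhds hS
  have hu := IsClopen.eq_univ ⟨S.isClosed_of_isOpen ho, ho⟩ ⟨1, S.one_mem⟩
  exact (hu.symm ▸ mem_univ g : g ∈ (S : Set G))

end LieGroupChart

namespace CarnotGroup

/-- A homomorphism of Lie groups with surjective differential is open. -/
theorem isOpenMap_of_hasMFDerivAt {G : CarnotGroup.{u}} {H : CarnotGroup.{v}} (p : G →* H)
    (hp : ContMDiff G.model H.model ∞ p)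
    {L : G.Coord →L[ℝ] H.Coord} (hL : HasMFDerivAt G.model H.model p 1 L)
    (hs : Function.Surjective L) :
    IsOpenMap p := by
  have h1 : ContDiffAt ℝ ∞ (fun y => chartOne H.Coord H (p ((chartOne G.Coord G).symm y)))
      (coordOne G.Coord G) := by
    rw [← contMDiffAt_iff_contDiffAt]
    have hc : ContMDiffAt 𝓘(ℝ, H.Coord) 𝓘(ℝ, H.Coord) ∞ (chartOne H.Coord H)
        (p ((chartOne G.Coord G).symm (coordOne G.Coord G))) := by
      rw [chartOne_symm_coordOne, map_one]; exact contMDiffAt_chartOne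
    exact ContMDiffAt.comp (coordOne G.Coord G) hc
      (hp.contMDiffAt.comp _ (contMDiffAt_chartOne_symm (E := G.Coord) (G := G)))
  have h2 := HasMFDerivAt.comp (1 : G) (hasMFDerivAt_congr_point
    (hasMFDerivAt_chartOne (E := H.Coord) (G := H)) (map_one p).symm) hL
  have h3 : HasFDerivAt (fun y => chartOne H.Coord H (p ((chartOne G.Coord G).symm y))) L (coordOne G.Coord G) :=
    (hasMFDerivAt_one_iff.1 h2).2
  have h4 := h1.hasStrictFDerivAt (by simp)
  rw [h3.fderiv] at h4
  have h5 := h4.map_nhds_eq_of_surj (LinearMap.range_eq_top.2 hs)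
  rw [chartOne_symm_coordOne, map_one, chartOne_one] at h5
  -- Openness is needed only at the identity; left translations carry it elsewhere.
  have key : 𝓝 (1 : H) ≤ map p (𝓝 1) := by
    intro U hU
    rw [mem_map] at hU
    have hU' : ∀ᶠ y in 𝓝 (coordOne G.Coord G), p ((chartOne G.Coord G).symm y) ∈ U ∧
        p ((chartOne G.Coord G).symm y) ∈ (chartOne H.Coord H).source := by
      have t1 : ∀ᶠ y in 𝓝 (coordOne G.Coord G), p ((chartOne G.Coord G).symm y) ∈ U :=
        tendsto_chartOne_symm (E := G.Coord) (G := G) hU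
      have t2 : Tendsto p (𝓝 1) (𝓝 1) := by
        simpa using (hp.continuous.tendsto (1 : G))
      exact t1.and ((t2.comp (tendsto_chartOne_symm (E := G.Coord) (G := G)))
        chartOne_source_mem_nhds)
    have h6 : ∀ᶠ z in 𝓝 (coordOne H.Coord H), ∃ h ∈ U, h ∈ (chartOne H.Coord H).source ∧
        chartOne H.Coord H h = z := by
      rw [← h5]
      exact eventually_map.2 (hU'.mono fun y hy => ⟨_, hy.1, hy.2, rfl⟩)
    filter_upwards [tendsto_chartOne (E := H.Coord) (G := H) h6,
      chartOne_source_mem_nhds (E := H.Coord) (G := H)] with g hg hgs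
    obtain ⟨h, hh, hhs, he⟩ := hg
    rwa [← (chartOne H.Coord H).injOn hhs hgs he]
  rw [isOpenMap_iff_nhds_le]
  intro g
  rw [← map_mul_left_nhds_one, ← map_mul_left_nhds_one g, map_map]
  have e : p ∘ (fun x => g * x) = (fun x => p g * x) ∘ p := by ext x; simp
  rw [e, ← map_map]
  exact map_mono key

end CarnotGroup

/-! ### Topology and centrality of the kernel of an extension. -/

namespace CentralExtension

variable {V : Type w} [NormedAddCommGroup V] [InnerProductSpace ℝ V] [FiniteDimensional ℝ V]
  {G : CarnotGroup.{u}} {H : CarnotGroup.{v}} (E : CentralExtension V G H)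

theorem incl_zero : E.incl 0 = 1 := by
  have := E.incl_add 0 0
  rw [add_zero] at this
  exact left_eq_mul.1 this

theorem incl_neg (v : V) : E.incl (-v) = (E.incl v)⁻¹ := by
  rw [eq_inv_iff_mul_eq_one, ← E.incl_add, neg_add_cancel, E.incl_zero]

theorem incl_sub (v w : V) : E.incl (v - w) = E.incl v * (E.incl w)⁻¹ := by
  rw [sub_eq_add_neg, E.incl_add, E.incl_neg]

theorem proj_incl (v : V) : E.proj (E.incl v) = 1 := (E.exact _).2 ⟨v, rfl⟩

/-- The differential of the inclusion. -/
def inclLie : V →ₗ[ℝ] G.LieAlg := E.split.symm.toLinearMap ∘ₗ LinearMap.inr ℝ H.LieAlg V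

/-- The differential of the projection. -/
def projLie : G.LieAlg →ₗ[ℝ] H.LieAlg := LinearMap.fst ℝ H.LieAlg V ∘ₗ E.split.toLinearMap

theorem inclLie_apply (v : V) : E.inclLie v = E.split.symm (0, v) := rfl

theorem inclLie_injective : Function.Injective E.inclLie := fun v w h => by
  have := E.split.symm.injective h
  exact congrArg Prod.snd this

theorem projLie_surjective : Function.Surjective E.projLie := fun Y =>
  ⟨E.split.symm (Y, 0), by simp [projLie]⟩

theorem lie_inclLie (Y : G.LieAlg) (v : V) : ⁅Y, E.inclLie v⁆ = 0 := by
  apply E.split.injective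
  rw [E.split_bracket, inclLie_apply, LinearEquiv.apply_symm_apply]
  refine Eq.trans ?_ (map_zero E.split).symm
  have : LieGroup H.model (minSmoothness ℝ 3) H := by
    rw [minSmoothness_of_isRCLikeNormedField]; infer_instance
  exact Prod.ext (lie_zero _) (map_zero _)

theorem exists_hasMFDerivAt_incl : ∃ L : V →L[ℝ] G.Coord,
    HasMFDerivAt 𝓘(ℝ, V) G.model E.incl 0 L ∧ ∀ v, L v = E.inclLie v :=
  ⟨mfderiv 𝓘(ℝ, V) G.model E.incl 0, (E.incl_smooth.mdifferentiable (by simp) (0 : V)).hasMFDerivAt,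
    E.mfderiv_incl⟩

theorem isOpenMap_proj : IsOpenMap E.proj :=
  CarnotGroup.isOpenMap_of_hasMFDerivAt E.proj E.proj_smooth
    (E.proj_smooth.mdifferentiable (by simp) 1).hasMFDerivAt fun Y => by
    obtain ⟨X, hX⟩ := E.projLie_surjective Y
    exact ⟨X, (E.mfderiv_proj X).trans hX⟩

/-- The open mapping theorem for a σ-compact group applies to `V` onto the closed, hence locally
compact, kernel of `proj`; so the inclusion is a topological embedding. -/
theorem comap_incl_nhds_one_le : comap E.incl (𝓝 1) ≤ 𝓝 0 := by
  let f : Multiplicative V →* E.proj.ker :=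
    { toFun := fun v => ⟨E.incl v.toAdd, E.proj_incl _⟩
      map_one' := Subtype.ext E.incl_zero
      map_mul' := fun v w => Subtype.ext (E.incl_add _ _) }
  have hsurj : Function.Surjective f := by
    rintro ⟨g, hg⟩
    obtain ⟨v, rfl⟩ := (E.exact g).1 hg
    exact ⟨Multiplicative.ofAdd v, rfl⟩
  have hcont : Continuous f :=
    (E.incl_smooth.continuous.comp continuous_toAdd).subtype_mk _
  have : ProperSpace V := FiniteDimensional.proper_real V
  have : SigmaCompactSpace (Multiplicative V) := inferInstanceAs (SigmaCompactSpace V)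
  have hcl : IsClosed (E.proj.ker : Set G) :=
    isClosed_singleton.preimage E.proj_smooth.continuous
  have : LocallyCompactSpace E.proj.ker := hcl.locallyCompactSpace
  have ho : IsOpenMap f := f.isOpenMap_of_sigmaCompact hsurj hcont
  intro U hU
  have h1 : f '' (Multiplicative.toAdd ⁻¹' U) ∈ 𝓝 (1 : E.proj.ker) := by
    have : Multiplicative.toAdd ⁻¹' U ∈ 𝓝 (1 : Multiplicative V) :=
      continuous_toAdd.continuousAt (by exact hU)
    simpa using ho.image_mem_nhds this
  rw [nhds_subtype_eq_comap] at h1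
  obtain ⟨W, hW, hWU⟩ := h1
  refine ⟨W, hW, fun v hv => ?_⟩
  have h2 : f (Multiplicative.ofAdd v) ∈ f '' (Multiplicative.toAdd ⁻¹' U) := hWU hv
  obtain ⟨w, hw, hwe⟩ := h2
  have : w.toAdd = v := E.incl_injective (congrArg Subtype.val hwe)
  exact this ▸ hw

/-- The kernel of a central extension is central. -/
theorem incl_comm (g : G) (v : V) : g * E.incl v = E.incl v * g := by
  -- Conjugation by `g` preserves the kernel and so induces an additive map `A` of `V`. It is
  -- continuous, hence linear, and comparing derivatives at `0` shows that `A` is the identity.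
  have hex : ∀ v, ∃ w, E.incl w = g * E.incl v * g⁻¹ := fun v => (E.exact _).1 (by simp [E.proj_incl])
  choose A hA using hex
  have hadd : ∀ v w, A (v + w) = A v + A w := fun v w => E.incl_injective (by
    rw [hA, E.incl_add, E.incl_add, hA, hA]; group)
  let A' : V →+ V := ⟨⟨A, E.incl_injective (by rw [hA, E.incl_zero]; simp)⟩, hadd⟩
  have hA0 : A 0 = 0 := A'.map_zero
  have hcont : Continuous A' := by
    refine continuous_of_continuousAt_zero A' ?_
    have h1 : Tendsto (fun v => E.incl (A v)) (𝓝 0) (𝓝 1) := by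
      simp only [hA]
      have : Continuous fun v => g * E.incl v * g⁻¹ :=
        (continuous_const.mul E.incl_smooth.continuous).mul continuous_const
      exact this.tendsto' _ _ (by simp [E.incl_zero])
    rw [ContinuousAt, map_zero]
    exact (tendsto_comap_iff.2 h1).mono_right E.comap_incl_nhds_one_le
  let L : V →L[ℝ] V := A'.toRealLinearMap hcont
  obtain ⟨I, hI, hIE⟩ := E.exists_hasMFDerivAt_incl
  have h1 : HasMFDerivAt 𝓘(ℝ, V) G.model (E.incl ∘ L) 0 (I.comp L) :=
    HasMFDerivAt.comp (0 : V) (by rw [map_zero]; exact hI) L.hasMFDerivAt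
  have hconj : HasMFDerivAt G.model G.model (fun y : G => g * y * g⁻¹) (E.incl 0)
      (adj G.Coord g) := by
    rw [E.incl_zero]; exact hasMFDerivAt_conj g
  have h2 := HasMFDerivAt.comp (0 : V) hconj hI
  have e : E.incl ∘ L = (fun y : G => g * y * g⁻¹) ∘ E.incl := funext hA
  rw [e] at h1
  have h3 : I (A v) = adj G.Coord g (I v) :=
    congrArg (fun L : V →L[ℝ] G.Coord => L v) (hasMFDerivAt_unique h1 h2)
  rw [hIE, hIE] at h3
  have h4 : E.inclLie (A v) = E.inclLie v := Eq.trans h3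
    (adj_apply_eq_of_lie_eq_zero (E := G.Coord) (E.inclLie v) (fun Y => E.lie_inclLie Y v) g)
  have h5 := hA v
  rw [E.inclLie_injective h4] at h5
  exact (eq_mul_inv_iff_mul_eq.1 h5).symm

theorem isPreconnected_preimage_proj {U : Set H} (hU : IsPreconnected U) :
    IsPreconnected (E.proj ⁻¹' U) := by
  refine hU.preimage_of_isOpenMap_of_fibers E.isOpenMap_proj
    (fun y _ => E.proj_surjective y) fun y _ => ?_
  obtain ⟨g, rfl⟩ := E.proj_surjective y
  have : E.proj ⁻¹' {E.proj g} = (fun v => g * E.incl v) '' univ := by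
    ext h
    simp only [mem_preimage, mem_singleton_iff, image_univ, mem_range]
    constructor
    · intro hh
      obtain ⟨v, hv⟩ := (E.exact (g⁻¹ * h)).1 (by simp [hh])
      exact ⟨v, by rw [hv]; group⟩
    · rintro ⟨v, rfl⟩
      simp [E.proj_incl]
  rw [this]
  exact isPreconnected_univ.image _ (continuous_const.mul E.incl_smooth.continuous).continuousOn

end CentralExtension

/-! ### Equal ranks and the quadratic estimate on the kernel. -/

theorem iSupIndep.eq_of_le_of_iSup_eq_top {ι α : Type*} [CompleteLattice α] [IsModularLattice α]
    {f g : ι → α} (hf : iSupIndep f) (hg : ∀ i, g i ≤ f i) (htop : ⨆ i, g i = ⊤) (i : ι) :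
    g i = f i := by
  refine le_antisymm (hg i) ?_
  have h1 : g i ⊔ ⨆ (j) (_ : j ≠ i), f j = ⊤ := by
    refine eq_top_iff.2 (htop ▸ iSup_le fun j => ?_)
    by_cases h : j = i
    · exact h ▸ le_sup_left
    · exact (hg j).trans (le_sup_of_le_right (le_iSup₂_of_le j h le_rfl))
  calc f i = (g i ⊔ ⨆ (j) (_ : j ≠ i), f j) ⊓ f i := by rw [h1, top_inf_eq]
    _ = g i ⊔ (⨆ (j) (_ : j ≠ i), f j) ⊓ f i := sup_inf_assoc_of_le _ (hg i)
    _ = g i := by rw [inf_comm, (hf i).eq_bot, sup_bot_eq]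
    _ ≤ g i := le_rfl

namespace CentralExtension

variable {V : Type w} [NormedAddCommGroup V] [InnerProductSpace ℝ V] [FiniteDimensional ℝ V]
  {G : CarnotGroup.{u}} {H : CarnotGroup.{v}} (E : CentralExtension V G H)

theorem map_projLie_layer (k : ℕ) : (G.layer k).map E.projLie = H.layer k := by
  refine H.layer_isInternal.submodule_iSupIndep.eq_of_le_of_iSup_eq_top
    (g := fun k => (G.layer k).map E.projLie) (fun k => ?_) ?_ k
  · rintro _ ⟨X, hX, rfl⟩
    exact E.proj_graded k X hX
  · rw [← Submodule.map_iSup, G.layer_isInternal.submodule_iSup_eq_top, Submodule.map_top]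
    exact LinearMap.range_eq_top.2 E.projLie_surjective

/-- The projection maps the first layer onto the first layer; equal dimensions make it injective
there, while it kills the image of `V`. -/
theorem eq_zero_of_inclLie_mem_layer_one (hrank : G.rank = H.rank) {v : V}
    (hv : E.inclLie v ∈ G.layer 1) : v = 0 := by
  let p : G.layer 1 →ₗ[ℝ] H.layer 1 := E.projLie.restrict fun X hX => E.proj_graded 1 X hX
  have hp : Function.Surjective p := by
    rintro ⟨Y, hY⟩
    obtain ⟨X, hX, rfl⟩ := (E.map_projLie_layer 1).symm ▸ hY
    exact ⟨⟨X, hX⟩, rfl⟩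
  have hinj := (LinearMap.injective_iff_surjective_of_finrank_eq_finrank hrank).2 hp
  have h0 : p ⟨_, hv⟩ = p 0 := by
    rw [map_zero]
    apply Subtype.ext
    show (E.split (E.split.symm (0, v))).1 = 0
    simp
  exact E.inclLie_injective ((congrArg Subtype.val (hinj h0)).trans (map_zero _).symm)

/-- Since `V` injects into the quotient of `𝔤` by the first layer, a left inverse of that injection
can be pulled back to `𝔤`. -/
theorem exists_retraction (hrank : G.rank = H.rank) : ∃ P : G.LieAlg →ₗ[ℝ] V,
    (∀ v, P (E.inclLie v) = v) ∧ ∀ X ∈ G.layer 1, P X = 0 := by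
  obtain ⟨Q, hQ⟩ := ((G.layer 1).mkQ ∘ₗ E.inclLie).exists_leftInverse_of_injective
    (LinearMap.ker_eq_bot'.2 fun v hv => E.eq_zero_of_inclLie_mem_layer_one hrank
      ((Submodule.Quotient.mk_eq_zero _).1 hv))
  refine ⟨Q ∘ₗ (G.layer 1).mkQ, fun v => LinearMap.congr_fun hQ v, fun X hX => ?_⟩
  have : (G.layer 1).mkQ X = 0 := (Submodule.Quotient.mk_eq_zero _).2 hX
  rw [LinearMap.comp_apply, this, map_zero]

/-- If the extension does not change the rank, the inclusion of the kernel shortens small distances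
at least quadratically. -/
theorem exists_norm_le_ccDist_sq (hrank : G.rank = H.rank) : ∃ (C : ℝ≥0) (ε : ℝ≥0), 0 < ε ∧
    ∀ v, G.ccDist 1 (E.incl v) < ε → ENNReal.ofReal ‖v‖ ≤ C * G.ccDist 1 (E.incl v) ^ 2 := by
  obtain ⟨P, hPi, hP1⟩ := E.exists_retraction hrank
  obtain ⟨P', hP'⟩ : ∃ P' : G.Coord →L[ℝ] V, ∀ X : G.LieAlg, P' X = P X :=
    ⟨LinearMap.toContinuousLinearMap
      (⟨⟨fun X : G.Coord => P X, fun X Y => map_add P X Y⟩, fun c X => map_smul P c X⟩ :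
        G.Coord →ₗ[ℝ] V), fun X => rfl⟩
  obtain ⟨f, -⟩ := (SmoothBumpFunction.nhds_basis_support (I := G.model) (c := (1 : G))
    univ_mem).ex_mem
  let B := Module.finBasis ℝ V
  let l : Fin (Module.finrank ℝ V) → V →L[ℝ] ℝ := fun i => LinearMap.toContinuousLinearMap (B.coord i)
  -- Cut-off coordinates of `P` in the chart. Their differential at `1` factors through `P`, so it
  -- vanishes on the first layer and `exists_sq_bound` applies.
  let φ : Fin (Module.finrank ℝ V) → G → ℝ := fun i x =>
    f x • l i (P' (chartOne G.Coord G x - coordOne G.Coord G))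
  have hφ : ∀ i, ContMDiff G.model 𝓘(ℝ, ℝ) ∞ (φ i) := fun i => by
    refine f.contMDiff_smul ?_
    have h1 := contMDiffOn_extChartAt (I := G.model) (n := ∞) (x := (1 : G))
    have h2 : ContMDiff 𝓘(ℝ, G.Coord) 𝓘(ℝ, ℝ) ∞
        (fun y : G.Coord => l i (P' (y - coordOne G.Coord G))) :=
      ((l i).contDiff.comp (P'.contDiff.comp (contDiff_id.sub contDiff_const))).contMDiff
    exact h2.comp_contMDiffOn h1
  have hφc : ∀ i, HasCompactSupport (φ i) := fun i => f.hasCompactSupport.smul_right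
  have hf1 : ∀ᶠ g in 𝓝 (1 : G), f g = 1 := f.eventuallyEq_one
  have hφd : ∀ i, ∀ X : G.LieAlg, X ∈ G.layer 1 → leftDiff G.Coord (φ i) 1 X = 0 := by
    intro i X hX
    have h1 := HasMFDerivAt.comp (1 : G) (g := fun y : G.Coord => l i (P' (y - coordOne G.Coord G)))
      (HasFDerivAt.hasMFDerivAt ((l i).hasFDerivAt.comp _
        (P'.hasFDerivAt.comp _ ((hasFDerivAt_id _).sub_const _))))
      (hasMFDerivAt_chartOne (E := G.Coord) (G := G))
    have h2 := hasMFDerivAt_leftDiff (E := G.Coord) (hφ i) 1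
    have h3 := h2.congr_of_eventuallyEq (f₁ :=
      (fun y : G.Coord => l i (P' (y - coordOne G.Coord G))) ∘ chartOne G.Coord G) (by
        filter_upwards [hf1] with g hg
        simp [φ, hg])
    have h4 := congrArg (fun L : G.Coord →L[ℝ] ℝ => L X) (hasMFDerivAt_unique h3 h1)
    refine h4.trans ?_
    show l i (P' X) = 0
    rw [hP', hP1 X hX, map_zero]
  choose C hC using fun i => CarnotGroup.exists_sq_bound (hφ i) (hφc i) (hφd i)
  have hφ1 : ∀ i, φ i 1 = 0 := fun i => by simp [φ, chartOne_one]
  obtain ⟨I, hI, hIE⟩ := E.exists_hasMFDerivAt_incl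
  let Q : V → V := fun v => P' (chartOne G.Coord G (E.incl v) - coordOne G.Coord G)
  have hQ0 : Q 0 = 0 := by simp [Q, E.incl_zero, chartOne_one]
  -- As `P` inverts the differential of the inclusion, `Q v` equals `v` to first order, so its norm
  -- controls `‖v‖` near `0`.
  have hQ : HasFDerivAt Q (ContinuousLinearMap.id ℝ V) 0 := by
    have h1 := HasMFDerivAt.comp (0 : V) (hasMFDerivAt_congr_point
      (hasMFDerivAt_chartOne (E := G.Coord) (G := G)) E.incl_zero.symm) hI
    have h2 : HasFDerivAt (fun v => chartOne G.Coord G (E.incl v)) I 0 :=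
      hasMFDerivAt_iff_hasFDerivAt.1 h1
    refine (P'.hasFDerivAt.comp 0 (h2.sub_const _)).congr_fderiv ?_
    ext v
    show P' (I v) = v
    rw [hIE, hP', hPi]
  have hQn : ∀ᶠ v in 𝓝 (0 : V), ‖v‖ ≤ 2 * ‖Q v‖ := by
    have h1 := (hasFDerivAt_iff_isLittleO_nhds_zero.1 hQ).bound (c := 1 / 2) (by norm_num)
    filter_upwards [h1] with v hv
    rw [zero_add, hQ0, sub_zero, ContinuousLinearMap.id_apply] at hv
    have := norm_sub_norm_le v (Q v)
    rw [norm_sub_rev] at this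
    linarith
  have hQv : ∀ v : V, ‖v‖ ≤ ∑ i, ‖B i‖ * |l i v| := fun v => by
    conv_lhs => rw [← B.sum_repr v]
    refine (norm_sum_le _ _).trans (Finset.sum_le_sum fun i _ => ?_)
    rw [norm_smul, mul_comm]; rfl
  have hnear : ∀ᶠ v in 𝓝 (0 : V), ‖v‖ ≤ 2 * ∑ i, ‖B i‖ * |φ i (E.incl v)| := by
    have : ∀ᶠ v in 𝓝 (0 : V), f (E.incl v) = 1 :=
      (E.incl_smooth.continuous.tendsto' 0 1 E.incl_zero).eventually hf1
    filter_upwards [hQn, this] with v h1 h2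
    refine h1.trans (mul_le_mul_of_nonneg_left ((hQv _).trans_eq ?_) zero_le_two)
    simp [φ, h2, Q]
  -- Smallness of `v` is turned into smallness of `ι v`, first in the topology of `G`, then in the
  -- sub-Riemannian distance.
  obtain ⟨W, hW, hWU⟩ := E.comap_incl_nhds_one_le hnear
  obtain ⟨ε, hε, hεW⟩ := CarnotGroup.exists_ccDist_lt_subset hW
  refine ⟨2 * ∑ i, ‖B i‖₊ * C i, ε, hε, fun v hv => ?_⟩
  have h1 : ‖v‖ ≤ 2 * ∑ i, ‖B i‖ * |φ i (E.incl v)| := hWU (hεW _ hv)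
  refine (ENNReal.ofReal_le_ofReal h1).trans ?_
  rw [ENNReal.ofReal_mul zero_le_two, ENNReal.ofReal_sum_of_nonneg (fun i _ => by positivity)]
  push_cast
  rw [mul_assoc, Finset.sum_mul, ENNReal.ofReal_ofNat]
  gcongr with i
  rw [ENNReal.ofReal_mul (norm_nonneg _), mul_assoc, ofReal_norm, enorm_eq_nnnorm]
  gcongr
  have := hC i _ (hv.trans ENNReal.coe_lt_top).ne
  rwa [hφ1, sub_zero] at this

end CentralExtension

/-! ### Rigidity of Hölder maps into the kernel and of Hölder lifts. -/

theorem ENNReal.tendsto_const_mul_rpow_zero (C : ℝ≥0) {β : ℝ} (hβ : 0 < β) :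
    Tendsto (fun x : ℝ≥0∞ => C * x ^ β) (𝓝 0) (𝓝 0) := by
  have h : Continuous fun x : ℝ≥0∞ => (C : ℝ≥0∞) * x ^ β :=
    (ENNReal.continuous_const_mul ENNReal.coe_ne_top).comp ENNReal.continuous_rpow_const
  exact h.tendsto' _ _ (by simp [hβ])

namespace CarnotGroup

variable {G : CarnotGroup.{u}}

theorem ccDist_eq_one_inv_mul (x y : G) : G.ccDist x y = G.ccDist 1 (x⁻¹ * y) := by
  rw [← ccDist_mul_left x⁻¹ x y, inv_mul_cancel]

theorem tendsto_ccDist_one : Tendsto (G.ccDist 1) (𝓝 1) (𝓝 0) :=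
  ENNReal.nhds_zero_basis.tendsto_right_iff.2 fun _ hε => setOf_ccDist_one_lt_mem_nhds hε

theorem setOf_ccDist_lt_mem_nhds (x : G) {ε : ℝ≥0∞} (hε : 0 < ε) :
    {g : G | G.ccDist x g < ε} ∈ 𝓝 x := by
  have h : Tendsto (fun g => x⁻¹ * g) (𝓝 x) (𝓝 1) :=
    (continuous_const_mul x⁻¹).tendsto' _ _ (by simp)
  filter_upwards [h (setOf_ccDist_one_lt_mem_nhds hε)] with g hg
  rw [ccDist_eq_one_inv_mul]
  exact hg

theorem exists_setOf_ccDist_lt_subset {x : G} {U : Set G} (hU : U ∈ 𝓝 x) :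
    ∃ ε : ℝ≥0, 0 < ε ∧ ∀ g, G.ccDist x g < ε → g ∈ U := by
  have h : Tendsto (fun g => x * g) (𝓝 1) (𝓝 x) := (continuous_const_mul x).tendsto' _ _ (by simp)
  obtain ⟨ε, hε, hs⟩ := exists_ccDist_lt_subset (h hU)
  refine ⟨ε, hε, fun g hg => ?_⟩
  rw [ccDist_eq_one_inv_mul] at hg
  simpa using hs _ hg

theorem ccDist_le_length_of_mem {γ : ℝ → G} (hγ : G.IsHorizontal γ) {t : ℝ} (ht : t ∈ Icc (0 : ℝ) 1) :
    G.ccDist (γ 0) (γ t) ≤ G.length γ := by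
  refine (ccDist_le_lengthOn hγ (by simp) ht).trans (lengthOn_mono γ ?_)
  rw [uIcc_of_le ht.1]
  exact Icc_subset_Icc_right ht.2

end CarnotGroup

namespace CentralExtension

variable {V : Type w} [NormedAddCommGroup V] [InnerProductSpace ℝ V] [FiniteDimensional ℝ V]
  {G : CarnotGroup.{u}} {H : CarnotGroup.{v}} (E : CentralExtension V G H)

/-- If the extension does not change the rank, a map to the kernel that is Hölder of exponent
greater than `1 / 2` is constant along rectifiable horizontal curves. -/
theorem eq_of_holder_on_curve (hrank : G.rank = H.rank) {G' : CarnotGroup} {S : Set G'}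
    {h : G' → V} {C : ℝ≥0} {β : ℝ} (hβ : 1 / 2 < β)
    (hC : ∀ p ∈ S, ∀ q ∈ S, G.ccDist 1 (E.incl (h p - h q)) ≤ C * G'.ccDist p q ^ β)
    {γ : ℝ → G'} (hγ : G'.IsHorizontal γ) (hlen : G'.length γ ≠ ⊤)
    (hS : ∀ t ∈ Icc (0 : ℝ) 1, γ t ∈ S) : h (γ 0) = h (γ 1) := by
  obtain ⟨K, ε, hε, hK⟩ := E.exists_norm_le_ccDist_sq hrank
  have hβ0 : 0 < β := by linarith
  -- On pieces shorter than `δ` the increments of `h` are within the range `ε` of the quadratic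
  -- estimate, which doubles the exponent `β`.
  obtain ⟨δ, hδ, hδε⟩ := ENNReal.nhds_zero_basis.eventually_iff.1
    ((ENNReal.tendsto_const_mul_rpow_zero C hβ0).eventually_lt_const (u := (ε : ℝ≥0∞))
      (ENNReal.coe_pos.2 hε))
  refine CarnotGroup.eq_of_edist_le_length_rpow hlen (f := fun t => h (γ t)) (α := 2 * β)
    (by linarith) (K := K * C ^ 2) hδ fun s hs t ht hst hl => ?_
  have h1 : G.ccDist 1 (E.incl (h (γ s) - h (γ t))) ≤
      C * CarnotGroup.lengthOn γ (Icc s t) ^ β := by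
    refine (hC _ (hS s hs) _ (hS t ht)).trans ?_
    have := CarnotGroup.ccDist_le_lengthOn hγ hs ht
    rw [uIcc_of_le hst] at this
    gcongr
  rw [edist_dist, dist_eq_norm]
  refine (hK _ (h1.trans_lt (hδε hl))).trans ?_
  calc _ ≤ (K : ℝ≥0∞) * (C * CarnotGroup.lengthOn γ (Icc s t) ^ β) ^ 2 := by gcongr
    _ = _ := by
      rw [mul_pow, ← ENNReal.rpow_mul_natCast]
      push_cast
      rw [mul_assoc, mul_comm β]

theorem ccDist_incl (v w : V) : G.ccDist (E.incl v) (E.incl w) = G.ccDist 1 (E.incl (v - w)) := by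
  rw [CarnotGroup.ccDist_comm, CarnotGroup.ccDist_eq_one_inv_mul, ← E.incl_neg, ← E.incl_add]
  congr 2; abel

/-- A curve from the centre of length less than `r` never leaves the ball, so neither connectedness
nor Chow's theorem is needed. -/
theorem eq_of_holder_on_ball (hrank : G.rank = H.rank) {G' : CarnotGroup} {x : G'} {r : ℝ}
    {h : G' → V} {β : ℝ} (hβ : 1 / 2 < β)
    (hh : CarnotGroup.IsHolderOn β (G'.ball x r) (fun g => E.incl (h g))) {p : G'}
    (hp : p ∈ G'.ball x r) : h x = h p := by
  obtain ⟨C, hC⟩ := hh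
  obtain ⟨γ, hγ, rfl, rfl, hl⟩ := CarnotGroup.exists_curve_of_ccDist_lt hp
  refine E.eq_of_holder_on_curve hrank hβ (S := G'.ball (γ 0) r) (C := C) (fun p hp q hq => ?_) hγ
    (hl.trans ENNReal.ofReal_lt_top).ne fun t ht =>
      (CarnotGroup.ccDist_le_length_of_mem hγ ht).trans_lt hl
  rw [← E.ccDist_incl]
  exact hC p hp q hq

/-- Short curves from `p` stay in `W`, and by Chow's theorem their endpoints fill a neighbourhood of
`p`. -/
theorem eventually_eq_of_holder (hrank : G.rank = H.rank) {G' : CarnotGroup} {W : Set G'}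
    (hW : IsOpen W) {h : G' → V} {C : ℝ≥0} {β : ℝ} (hβ : 1 / 2 < β)
    (hC : ∀ p ∈ W, ∀ q ∈ W, G.ccDist 1 (E.incl (h p - h q)) ≤ C * G'.ccDist p q ^ β) {p : G'}
    (hp : p ∈ W) : ∀ᶠ q in 𝓝 p, h p = h q := by
  obtain ⟨ε, hε, hεW⟩ := CarnotGroup.exists_setOf_ccDist_lt_subset (hW.mem_nhds hp)
  filter_upwards [CarnotGroup.setOf_ccDist_lt_mem_nhds p (ε := ε) (ENNReal.coe_pos.2 hε)] with q hq
  obtain ⟨γ, hγ, rfl, rfl, hl⟩ := CarnotGroup.exists_curve_of_ccDist_lt hq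
  exact E.eq_of_holder_on_curve hrank hβ hC hγ (hl.trans ENNReal.coe_lt_top).ne fun t ht =>
    hεW _ ((CarnotGroup.ccDist_le_length_of_mem hγ ht).trans_lt hl)

theorem eq_of_holder_on_isPreconnected (hrank : G.rank = H.rank) {G' : CarnotGroup} {W : Set G'}
    (hW : IsOpen W) (hWc : IsPreconnected W) {h : G' → V} {C : ℝ≥0} {β : ℝ} (hβ : 1 / 2 < β)
    (hC : ∀ p ∈ W, ∀ q ∈ W, G.ccDist 1 (E.incl (h p - h q)) ≤ C * G'.ccDist p q ^ β) {p q : G'}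
    (hp : p ∈ W) (hq : q ∈ W) : h p = h q := by
  refine hWc.induction₂ (fun p q => h p = h q) (fun p hp => ?_) (fun _ _ _ _ _ _ => Eq.trans)
    (fun _ _ _ _ => Eq.symm) hp hq
  exact nhdsWithin_le_nhds (E.eventually_eq_of_holder hrank hW hβ hC hp)

theorem ccDist_mul_incl (x y : G) (v : V) :
    G.ccDist (x * E.incl v) (y * E.incl v) = G.ccDist x y := by
  rw [E.incl_comm, E.incl_comm, CarnotGroup.ccDist_mul_left]

/-- By centrality `ι (v - w)` is the product of `(b⁻¹ a)⁻¹` and `(b ι w)⁻¹ (a ι v)`, whose distances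
to `1` are the two terms on the right. -/
theorem ccDist_incl_sub_le {a b : G} {v w : V} : G.ccDist 1 (E.incl (v - w)) ≤
    G.ccDist a b + G.ccDist (a * E.incl v) (b * E.incl w) := by
  have h : E.incl (v - w) = (b⁻¹ * a)⁻¹ * ((b * E.incl w)⁻¹ * (a * E.incl v)) := by
    have h1 := E.incl_comm (b⁻¹ * a) (-w)
    rw [E.incl_neg] at h1
    rw [E.incl_sub, mul_inv_rev b]
    calc E.incl v * (E.incl w)⁻¹ = (E.incl w)⁻¹ * E.incl v := by
          rw [← E.incl_neg, E.incl_comm]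
      _ = (b⁻¹ * a)⁻¹ * ((b⁻¹ * a) * (E.incl w)⁻¹) * E.incl v := by group
      _ = (b⁻¹ * a)⁻¹ * ((E.incl w)⁻¹ * (b⁻¹ * a)) * E.incl v := by rw [h1]
      _ = _ := by simp only [mul_assoc]
  rw [h]
  refine (CarnotGroup.ccDist_one_mul_le _ _).trans_eq ?_
  rw [CarnotGroup.ccDist_one_inv, ← CarnotGroup.ccDist_eq_one_inv_mul,
    ← CarnotGroup.ccDist_eq_one_inv_mul, CarnotGroup.ccDist_comm,
    CarnotGroup.ccDist_comm (b * E.incl w)]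

theorem exists_hom_of_holder_lift {V₁ : Type*} [NormedAddCommGroup V₁] [InnerProductSpace ℝ V₁]
    [FiniteDimensional ℝ V₁] {G₁ H₁ : CarnotGroup} (E₁ : CentralExtension V₁ G₁ H₁)
    (hrank : G.rank = H.rank) {β : ℝ} (hβ : 1 / 2 < β) {U : Set H₁} {f : H₁ → H} {F : G₁ → G}
    (hU : IsOpen U) (hUc : IsConnected U) (hF : CarnotGroup.IsHolderOn β (E₁.proj ⁻¹' U) F)
    (hlift : ∀ g ∈ E₁.proj ⁻¹' U, E.proj (F g) = f (E₁.proj g)) :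
    ∃ Φ : V₁ →+ V, ContDiff ℝ ∞ Φ ∧
      ∀ g ∈ E₁.proj ⁻¹' U, ∀ k : V₁, F (g * E₁.incl k) = F g * E.incl (Φ k) := by
  obtain ⟨C, hC⟩ := hF
  have hβ0 : 0 < β := by linarith
  set W := E₁.proj ⁻¹' U with hWdef
  have hWo : IsOpen W := hU.preimage E₁.proj_smooth.continuous
  have hWc : IsPreconnected W := E₁.isPreconnected_preimage_proj hUc.isPreconnected
  have hproj : ∀ g k, E₁.proj (g * E₁.incl k) = E₁.proj g := fun g k => by
    rw [map_mul, E₁.proj_incl, mul_one]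
  have hmem : ∀ g ∈ W, ∀ k, g * E₁.incl k ∈ W := fun g hg k => by
    rw [hWdef, mem_preimage, hproj]; exact hg
  have hex : ∀ k, ∀ g ∈ W, ∃ v, F (g * E₁.incl k) = F g * E.incl v := fun k g hg => by
    obtain ⟨v, hv⟩ := (E.exact ((F g)⁻¹ * F (g * E₁.incl k))).1 (by
      rw [map_mul, map_inv, hlift g hg, hlift _ (hmem g hg k), hproj, inv_mul_cancel])
    exact ⟨v, by rw [hv, mul_inv_cancel_left]⟩
  choose! h hh using hex
  have hconst : ∀ k, ∀ p ∈ W, ∀ q ∈ W, h k p = h k q := fun k p hp q hq => by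
    -- One `C` comes from the pair `p, q`, the other from the pair translated by `k`, which is at
    -- the same distance.
    refine E.eq_of_holder_on_isPreconnected hrank hWo hWc (C := C + C) hβ (fun p hp q hq => ?_) hp hq
    refine (E.ccDist_incl_sub_le (a := F p) (b := F q)).trans ?_
    rw [← hh k p hp, ← hh k q hq]
    refine (add_le_add (hC p hp q hq) (hC _ (hmem p hp k) _ (hmem q hq k))).trans_eq ?_
    rw [E₁.ccDist_mul_incl, ENNReal.coe_add, add_mul]
  obtain ⟨y, hy⟩ := hUc.nonempty
  obtain ⟨g, rfl⟩ := E₁.proj_surjective y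
  have hmul : ∀ p ∈ W, ∀ k, F (p * E₁.incl k) = F p * E.incl (h k g) := fun p hp k => by
    rw [hh k p hp, hconst k p hp g hy]
  have hadd : ∀ k l, h (k + l) g = h k g + h l g := fun k l => by
    apply E.incl_injective
    have h1 := hmul g hy (k + l)
    rw [E₁.incl_add, ← mul_assoc, hmul _ (hmem g hy k) l, hmul g hy k, mul_assoc] at h1
    rw [E.incl_add, mul_left_cancel h1]
  let Φ : V₁ →+ V := AddMonoidHom.mk' (fun k => h k g) hadd
  -- The Hölder bound at `g` and Chow's theorem in `G₁` give `ι (Φ k) → 1`; the embedding property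
  -- of `ι` gives `Φ k → 0`. A continuous additive map is real linear, hence smooth.
  have hcont : Continuous Φ := by
    refine continuous_of_continuousAt_zero Φ ?_
    have hdist : ∀ k, G.ccDist 1 (E.incl (Φ k)) ≤ C * G₁.ccDist 1 (E₁.incl k) ^ β := fun k => by
      have h1 := hC g hy _ (hmem g hy k)
      rw [hmul g hy k, CarnotGroup.ccDist_eq_one_inv_mul, inv_mul_cancel_left,
        CarnotGroup.ccDist_eq_one_inv_mul g, inv_mul_cancel_left] at h1
      exact h1
    have ht : Tendsto (fun k => (C : ℝ≥0∞) * G₁.ccDist 1 (E₁.incl k) ^ β) (𝓝 0) (𝓝 0) :=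
      (ENNReal.tendsto_const_mul_rpow_zero C hβ0).comp (CarnotGroup.tendsto_ccDist_one.comp
        (E₁.incl_smooth.continuous.tendsto' 0 1 E₁.incl_zero))
    have h1 : Tendsto (fun k => E.incl (Φ k)) (𝓝 0) (𝓝 1) := by
      intro U hU
      obtain ⟨ε, hε, hεU⟩ := CarnotGroup.exists_ccDist_lt_subset hU
      change ∀ᶠ k in 𝓝 0, E.incl (Φ k) ∈ U
      filter_upwards [ht.eventually_lt_const (u := (ε : ℝ≥0∞)) (ENNReal.coe_pos.2 hε)] with k hk
      exact hεU _ ((hdist k).trans_lt hk)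
    rw [ContinuousAt, map_zero]
    exact (tendsto_comap_iff.2 h1).mono_right E.comap_incl_nhds_one_le
  exact ⟨Φ, (Φ.toRealLinearMap hcont).contDiff, hmul⟩

end CentralExtension

end

theorem theorem6p6 {V₁ V₂ : Type*}
    [NormedAddCommGroup V₁] [InnerProductSpace ℝ V₁] [FiniteDimensional ℝ V₁]
    [NormedAddCommGroup V₂] [InnerProductSpace ℝ V₂] [FiniteDimensional ℝ V₂]
    (G₁ H₁ G₂ H₂ : CarnotGroup)
    (E₁ : CentralExtension V₁ G₁ H₁) (E₂ : CentralExtension V₂ G₂ H₂)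
    (hrank : G₂.rank = H₂.rank)
    (β : ℝ) (hβ : 1 / 2 < β) (hβ' : β ≤ 1) :
    (∀ (U₁ : Set H₁) (f : H₁ → H₂) (F : G₁ → G₂), IsOpen U₁ → IsConnected U₁ →
      (∃ γ : ℝ, 0 < γ ∧ γ ≤ 1 ∧ CarnotGroup.IsHolderOn γ U₁ f) →
      CarnotGroup.IsHolderOn β (E₁.proj ⁻¹' U₁) F →
      (∀ g ∈ E₁.proj ⁻¹' U₁, E₂.proj (F g) = f (E₁.proj g)) →
      ∃ Φ : V₁ →+ V₂, ContDiff ℝ ∞ Φ ∧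
        ∀ g ∈ E₁.proj ⁻¹' U₁, ∀ k : V₁, F (g * E₁.incl k) = F g * E₂.incl (Φ k)) ∧
    (∀ (x : G₁) (r : ℝ) (h : G₁ → V₂),
      CarnotGroup.IsHolderOn β (G₁.ball x r) (fun g => E₂.incl (h g)) →
      ∀ p ∈ G₁.ball x r, ∀ q ∈ G₁.ball x r, h p = h q) := by
  refine ⟨fun U₁ f F hU hUc _ hF hlift => ?_, fun x r h hh p hp q hq => ?_⟩
  · exact E₂.exists_hom_of_holder_lift E₁ hrank hβ hU hUc hF hlift
  · exact (E₂.eq_of_holder_on_ball hrank hβ hh hp).symm.trans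
      (E₂.eq_of_holder_on_ball hrank hβ hh hq)
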